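/- For an integer $d\ge 1$ and a real number $H\ge 1$, let $N_d(H)$ denote the number of triples $\mathbf a=(a_1,a_2,a_3)\in\mathbb Z^3$ with $|a_i|\le H$ for $i=1,2,3$ for which the equation $a_1x_1^d+a_2x_2^d+a_3x_3^d=0$ has a solution $(x_1,x_2,x_3)\in\mathbb Q^3$ with $(x_1,x_2,x_3)\ne(0,0,0)$. Let $$\psi(d)=\frac{3}{\phi(d)}\Big(1-\frac1d\Big),$$ where $\phi$ is Euler's totient function. Then for every integer $d\ge 1$ there is a constant $C_d>0$, depending only on $d$, such that $$N_d(H)\le C_d\,\frac{H^3}{(\log H)^{\psi(d)}}\qquad\text{for all real } H>1.$$ Consequently, for every $d\ge 2$ the soluble coefficient triples have density zero, that is, $$\frac{N_d(H)}{\#\{\mathbf a\in\mathbb Z^3:\ |a_i|\le H \text{ for } i=1,2,3\}}\longrightarrow 0\qquad (H\to\infty).$$ For $d=2$ the bound reads $N_2(H)\ll H^3/(\log H)^{3/2}$ for all $H>1$, with an absolute implied constant, which is Serre's bound. -/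

import Mathlib

/-- The triples `a` of integers with `|a i| ≤ H` for every `i`. -/
def coeffBox (H : ℝ) : Set (Fin 3 → ℤ) :=
  {a | ∀ i, |(a i : ℝ)| ≤ H}

/-- The curve `a₁ x₁ ^ d + a₂ x₂ ^ d + a₃ x₃ ^ d = 0` in the projective plane has a rational point,
that is, the equation has a nonzero rational solution. -/
def FermatSoluble (d : ℕ) (a : Fin 3 → ℤ) : Prop :=
  ∃ x : Fin 3 → ℚ, x ≠ 0 ∧
    (a 0 : ℚ) * x 0 ^ d + (a 1 : ℚ) * x 1 ^ d + (a 2 : ℚ) * x 2 ^ d = 0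

/-- The soluble coefficient triples of height at most `H`. -/
def solubleTriples (d : ℕ) (H : ℝ) : Set (Fin 3 → ℤ) :=
  {a | a ∈ coeffBox H ∧ FermatSoluble d a}

/-- `N_d(H)`, the number of soluble coefficient triples of height at most `H`. -/
noncomputable def solubleCount (d : ℕ) (H : ℝ) : ℕ :=
  (solubleTriples d H).ncard

/-- The exponent `ψ(d) = (3 / φ(d)) (1 - 1 / d)`. -/
noncomputable def fermatExponent (d : ℕ) : ℝ :=
  3 / (Nat.totient d : ℝ) * (1 - 1 / (d : ℝ))

theorem coeffBox_finite (H : ℝ) : (coeffBox H).Finite := by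
  refine (Set.Finite.pi' (fun _ : Fin 3 => Set.finite_Icc (-⌊H⌋) ⌊H⌋)).subset ?_
  intro a ha i
  have h := abs_le.mp (ha i)
  refine ⟨?_, Int.le_floor.mpr h.2⟩
  have : -a i ≤ ⌊H⌋ := Int.le_floor.mpr (by push_cast; linarith [h.1])
  linarith

theorem solubleTriples_finite (d : ℕ) (H : ℝ) : (solubleTriples d H).Finite :=
  (coeffBox_finite H).subset fun _ ha => ha.1

/-!
The bound comes from an upper bound sieve on the coefficient box, using a local obstruction at every
prime `p ≡ 1 (mod d)`. Suppose that `p` divides exactly one of the coefficients, and divides it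
exactly once, while the other two, `r` and `s`, are such that `r t ^ d + s u ^ d = 0` has only the
trivial solution modulo `p`. A primitive integer solution of the Fermat equation then has two
coordinates divisible by `p`; as `d ≥ 2`, comparing powers of `p` makes the third one divisible by `p`
as well, which is absurd (`FermatSoluble.notMem_obstructed`). Since the `d`-th powers have index `d` in
`(ℤ / p)ˣ`, the obstructed triples modulo `p ^ 2` have density `ω p = 3 (1 - 1 / d) (p - 1) ^ 3 / p ^ 4`
(`card_obstructed`), which is `3 (1 - 1 / d) / p + O(1 / p ^ 2)`.

The sieve is Selberg's, in a form that needs no diagonalisation. Let `h = ω / (1 - ω)`. The function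
that equals `-1` on the obstructed classes modulo `p ^ 2` and `h p` on the others has mean zero and mean
square `h p`. Products of these functions over different finite sets of primes are orthogonal by the
Chinese remainder theorem, so a sum of such products, over sets `T` of primes of bounded product, has
mean square `L = ∑ T, ∏ p ∈ T, h p`, while it is equal to `L` at every unobstructed triple. Hence at most
about a proportion `1 / L` of the triples is unobstructed (`card_sifted_le`). By Markov's inequality,
restricting to sets `T` whose product is at most a fixed power of `z` costs no more than half of
`∏ p ≤ z, (1 + h p)` (`half_prod_le_sum_truncated`), so that `z` can be a small power of `H`.

Finally `∏ p ≤ z, (1 + h p) ≥ exp (∑ p ≤ z, ω p)`, and what is needed is the lower bound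
`log log z / φ(d) - O(1)` for the sum of `1 / p` over the primes `p ≤ z` with `p ≡ 1 (mod d)`
(`exists_log_log_le_sum_one_div_prime`). It follows from the simple pole at `s = 1` of the Dirichlet
series of the von Mangoldt function restricted to this residue class: integrate over `s` from
`1 + 1 / log z` to `2`. The terms with `p > z` contribute a bounded amount, because there
`1 / log p ≤ 1 / log z`, while the Dirichlet series of the von Mangoldt function at `1 + 1 / log z` is
`log z + O(1)`.
-/

/-! ### Primes congruent to one modulo `d` -/

open ArithmeticFunction in
/-- The Dirichlet series of the von Mangoldt function has a pole of residue at most `1` at `1`: the case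
`q = 1` of the continuity of `LFunctionResidueClassAux`. -/
theorem exists_sum_vonMangoldt_le :
    ∃ C : ℝ, 0 ≤ C ∧ ∀ x : ℝ, 1 < x → x ≤ 2 →
      Summable (fun n : ℕ => vonMangoldt n / (n : ℝ) ^ x) ∧
        ∑' n : ℕ, vonMangoldt n / (n : ℝ) ^ x ≤ 1 / (x - 1) + C := by
  have hcont : ContinuousOn
      (fun x : ℝ => (vonMangoldt.LFunctionResidueClassAux (1 : ZMod 1) x).re) (Set.Icc 1 2) :=
    Complex.continuous_re.continuousOn.comp (t := Set.univ)
      (vonMangoldt.continuousOn_LFunctionResidueClassAux (1 : ZMod 1)) (fun _ _ => trivial)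
      |>.comp Complex.continuous_ofReal.continuousOn fun x hx => by
        simpa only [Set.mem_ofPred_eq, Complex.ofReal_re] using hx.1
  obtain ⟨C, hC⟩ := bddAbove_def.mp <| IsCompact.bddAbove_image isCompact_Icc hcont
  have hres : ∀ n : ℕ, vonMangoldt.residueClass (1 : ZMod 1) n = vonMangoldt n := fun n => by
    rw [vonMangoldt.residueClass, Set.indicator_apply, if_pos]
    exact Subsingleton.elim (α := ZMod 1) _ _
  refine ⟨max C 0, le_max_right _ _, fun x hx hx2 => ?_⟩
  have hsum : Summable (fun n : ℕ => vonMangoldt n / (n : ℝ) ^ x) := by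
    have := LSeries.summable_real_of_abscissaOfAbsConv_lt (x := x) <|
      (vonMangoldt.abscissaOfAbsConv_residueClass_le_one (1 : ZMod 1)).trans_lt <| mod_cast hx
    simpa only [hres] using this
  refine ⟨hsum, ?_⟩
  have key : ∑' n, vonMangoldt.residueClass (1 : ZMod 1) n / (n : ℝ) ^ x =
      (vonMangoldt.LFunctionResidueClassAux (1 : ZMod 1) x).re
        + ((1 : ℕ).totient : ℝ)⁻¹ / (x - 1) := by
    refine Complex.ofReal_injective ?_
    simp only [Complex.ofReal_tsum, Complex.ofReal_div, Complex.ofReal_cpow (Nat.cast_nonneg _),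
      Complex.ofReal_natCast, Complex.ofReal_add, Complex.ofReal_inv, Complex.ofReal_sub,
      Complex.ofReal_one]
    simp_rw [← vonMangoldt.LFunctionResidueClassAux_real isUnit_one hx,
      vonMangoldt.eqOn_LFunctionResidueClassAux (q := 1) (a := 1) isUnit_one <|
        Set.mem_ofPred.mpr (Complex.ofReal_re x ▸ hx), sub_add_cancel, LSeries, LSeries.term]
    refine tsum_congr fun n => ?_
    split_ifs with hn
    · simp [hn]
    · rfl
  simp only [hres] at key
  rw [key]
  have := hC _ (Set.mem_image_of_mem _ (⟨hx.le, hx2⟩ : x ∈ Set.Icc (1 : ℝ) 2))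
  have h2 := le_max_left C 0
  simp only [Nat.totient_one, Nat.cast_one, inv_one] at *
  linarith

theorem one_div_log_natCast_bounds {z : ℕ} (hz : 3 ≤ z) :
    0 < 1 / Real.log z ∧ 1 / Real.log z ≤ 1 ∧ 1 ≤ Real.log z := by
  have h1 : 1 ≤ Real.log z := by
    rw [Real.le_log_iff_exp_le (by positivity)]
    have : (3 : ℝ) ≤ z := by exact_mod_cast hz
    linarith [Real.exp_one_lt_d9]
  exact ⟨by positivity, by rw [div_le_one (by linarith)]; exact h1, h1⟩

/-- A weak form of Mertens' first theorem: for `p ≤ z` the factor `p ^ (1 / log z)` is at most `e`, so the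
sum is dominated by the Dirichlet series of the von Mangoldt function at `1 + 1 / log z`. -/
theorem exists_sum_log_div_le :
    ∃ C : ℝ, 0 < C ∧ ∀ z : ℕ, 3 ≤ z →
      ∑ p ∈ (Finset.range (z + 1)).filter Nat.Prime, Real.log p / p ≤ C * Real.log z := by
  obtain ⟨C, hC0, hC⟩ := exists_sum_vonMangoldt_le
  refine ⟨Real.exp 1 * (1 + C), by positivity, fun z hz => ?_⟩
  obtain ⟨hδ, hδ1, hlog⟩ := one_div_log_natCast_bounds hz
  obtain ⟨hs, hb⟩ := hC (1 + 1 / Real.log z) (by linarith) (by linarith)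
  have h1 : ∀ p ∈ (Finset.range (z + 1)).filter Nat.Prime, Real.log p / p ≤
      Real.exp 1 * (ArithmeticFunction.vonMangoldt p / (p : ℝ) ^ (1 + 1 / Real.log z)) := by
    intro p hp
    simp only [Finset.mem_filter, Finset.mem_range] at hp
    have hp0 : (0 : ℝ) < p := by exact_mod_cast hp.2.pos
    have hpz : Real.log p ≤ Real.log z :=
      Real.log_le_log hp0 (by exact_mod_cast Nat.lt_succ_iff.mp hp.1)
    rw [ArithmeticFunction.vonMangoldt_apply_prime hp.2, Real.rpow_add hp0, Real.rpow_one,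
      ← mul_div_assoc, div_le_div_iff₀ hp0 (by positivity)]
    have : (p : ℝ) ^ (1 / Real.log z) ≤ Real.exp 1 := by
      rw [Real.rpow_def_of_pos hp0]
      apply Real.exp_le_exp.mpr
      rw [mul_one_div, div_le_one (by linarith)]
      exact hpz
    have h0 : 0 ≤ Real.log p * p :=
      mul_nonneg (Real.log_natCast_nonneg p) hp0.le
    nlinarith [mul_le_mul_of_nonneg_left this h0]
  calc _ ≤ _ := Finset.sum_le_sum h1
    _ = Real.exp 1 * ∑ p ∈ (Finset.range (z + 1)).filter Nat.Prime,
        ArithmeticFunction.vonMangoldt p / (p : ℝ) ^ (1 + 1 / Real.log z) := by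
      rw [Finset.mul_sum]
    _ ≤ Real.exp 1 * (1 / ((1 + 1 / Real.log z) - 1) + C) := by
      gcongr
      refine (hs.sum_le_tsum _ fun n _ => ?_).trans hb
      exact div_nonneg ArithmeticFunction.vonMangoldt_nonneg (by positivity)
    _ = Real.exp 1 * (Real.log z + C) := by simp
    _ ≤ Real.exp 1 * (1 + C) * Real.log z := by
      rw [mul_assoc]
      gcongr
      nlinarith

/-- The lower bound `φ(d)⁻¹ / (s - 1) - C` for the Dirichlet series of the von Mangoldt function on the
class of `1` modulo `d`, integrated over `s ∈ [s₀, 2]`. A finite truncation of the series suffices, which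
reduces the integration to the monotonicity of an explicit function. -/
theorem exists_log_log_le_sum_residueClass (d : ℕ) [NeZero d] :
    ∃ C : ℝ, ∀ s₀ : ℝ, 1 < s₀ → s₀ ≤ 2 → ∃ X : ℕ,
      (d.totient : ℝ)⁻¹ * Real.log (1 / (s₀ - 1)) - C ≤
        ∑ n ∈ Finset.range X,
          ArithmeticFunction.vonMangoldt.residueClass (1 : ZMod d) n / Real.log n
            / (n : ℝ) ^ s₀ := by
  obtain ⟨C, hC⟩ := ArithmeticFunction.vonMangoldt.LSeries_residueClass_lower_bound
    (q := d) (a := 1) isUnit_one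
  set f := ArithmeticFunction.vonMangoldt.residueClass (1 : ZMod d) with hf
  set c : ℝ := (d.totient : ℝ)⁻¹ with hc
  have hf0 : ∀ n, 0 ≤ f n := ArithmeticFunction.vonMangoldt.residueClass_nonneg _
  have hf1 : ∀ n : ℕ, n < 2 → f n = 0 := by
    intro n hn
    refine le_antisymm ((ArithmeticFunction.vonMangoldt.residueClass_le _ n).trans ?_) (hf0 n)
    interval_cases n <;> simp
  refine ⟨|C + 1|, fun s₀ hs₀ hs₂ => ?_⟩
  have hsum : ∀ s : ℝ, 1 < s → Summable (fun n : ℕ => f n / (n : ℝ) ^ s) := fun s hs =>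
    LSeries.summable_real_of_abscissaOfAbsConv_lt <|
      (ArithmeticFunction.vonMangoldt.abscissaOfAbsConv_residueClass_le_one (1 : ZMod d)).trans_lt
        <| mod_cast hs
  -- The tail of the series is decreasing in `s`, so truncating well at `s₀` truncates well on `[s₀, 2]`.
  obtain ⟨X, hX⟩ : ∃ X : ℕ, ∑' n, f n / (n : ℝ) ^ s₀ - 1 ≤
      ∑ n ∈ Finset.range X, f n / (n : ℝ) ^ s₀ :=
    (((hsum s₀ hs₀).hasSum.tendsto_sum_nat).eventually (eventually_ge_nhds (by linarith))).exists
  refine ⟨X, ?_⟩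
  have htail : ∀ s ∈ Set.Icc s₀ 2, c / (s - 1) - (C + 1) ≤
      ∑ n ∈ Finset.range X, f n / (n : ℝ) ^ s := by
    intro s hs
    have h1 := hC (x := s) ⟨by linarith [hs.1], hs.2⟩
    have e0 := (hsum s₀ hs₀).sum_add_tsum_nat_add X
    have e1 := (hsum s (by linarith [hs.1])).sum_add_tsum_nat_add X
    have h2 : ∑' n, f (n + X) / ((n + X : ℕ) : ℝ) ^ s ≤ ∑' n, f (n + X) / ((n + X : ℕ) : ℝ) ^ s₀ := by
      refine Summable.tsum_le_tsum (fun n => ?_)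
        ((summable_nat_add_iff X).mpr (hsum s (by linarith [hs.1])))
        ((summable_nat_add_iff X).mpr (hsum s₀ hs₀))
      rcases Nat.lt_or_ge (n + X) 2 with h | h
      · simp [hf1 _ h]
      · have : (1 : ℝ) ≤ ((n + X : ℕ) : ℝ) := by exact_mod_cast (by omega : 1 ≤ n + X)
        refine div_le_div_of_nonneg_left (hf0 _) (by positivity) ?_
        exact Real.rpow_le_rpow_of_exponent_le this hs.1
    linarith
  let G : ℝ → ℝ := fun s => ∑ n ∈ Finset.range X, f n / Real.log n / (n : ℝ) ^ s
    + c * Real.log (s - 1) - (C + 1) * s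
  have hG : ∀ s ∈ Set.Icc s₀ 2, HasDerivAt G
      (∑ n ∈ Finset.range X, -(f n / (n : ℝ) ^ s) + c * (1 / (s - 1)) - (C + 1) * 1) s := by
    intro s hs
    refine ((HasDerivAt.fun_sum fun n _ => ?_).add (HasDerivAt.const_mul c ?_)).sub
      ((hasDerivAt_id s).const_mul _)
    · rcases Nat.lt_or_ge n 2 with h | h
      · simpa [hf1 _ h] using hasDerivAt_const s (0 : ℝ)
      · have hn : (1 : ℝ) < n := by exact_mod_cast h
        have hl : Real.log n ≠ 0 := (Real.log_pos hn).ne'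
        have h1 : HasDerivAt (fun s : ℝ => (n : ℝ) ^ (-s))
            (Real.log n * -1 * (n : ℝ) ^ (-s)) s :=
          HasDerivAt.const_rpow (by linarith) (hasDerivAt_neg s)
        have h2 := h1.const_mul (f n / Real.log n)
        have hfun : (fun s : ℝ => f n / Real.log n / (n : ℝ) ^ s) =
            fun s : ℝ => f n / Real.log n * (n : ℝ) ^ (-s) := by
          funext t
          rw [Real.rpow_neg (by linarith), div_eq_mul_inv]
        rw [hfun]
        convert! h2 using 1
        rw [Real.rpow_neg (by linarith)]
        field_simp
    · exact HasDerivAt.log ((hasDerivAt_id s).sub_const 1) (by simp; linarith [hs.1])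
  have hanti : AntitoneOn G (Set.Icc s₀ 2) := by
    refine antitoneOn_of_deriv_nonpos (convex_Icc _ _)
      (fun s hs => (hG s hs).continuousAt.continuousWithinAt)
      (fun s hs => (hG s (interior_subset hs)).differentiableAt.differentiableWithinAt)
      fun s hs => ?_
    rw [(hG s (interior_subset hs)).deriv, Finset.sum_neg_distrib]
    have := htail s (interior_subset hs)
    rw [mul_one_div]
    linarith
  have h := hanti ⟨le_rfl, hs₂⟩ ⟨hs₂, le_rfl⟩ hs₂
  have hpos : 0 ≤ ∑ n ∈ Finset.range X, f n / Real.log n / (n : ℝ) ^ (2 : ℝ) :=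
    Finset.sum_nonneg fun n _ =>
      div_nonneg (div_nonneg (hf0 n) (Real.log_natCast_nonneg n)) (by positivity)
  simp only [G] at h
  rw [show (2 : ℝ) - 1 = 1 by norm_num, Real.log_one, mul_zero, add_zero] at h
  rw [one_div, Real.log_inv]
  have h3 : (C + 1) * (2 - s₀) ≤ |C + 1| := by
    calc (C + 1) * (2 - s₀) ≤ |C + 1| * (2 - s₀) :=
          mul_le_mul_of_nonneg_right (le_abs_self _) (by linarith)
      _ ≤ |C + 1| * 1 := by gcongr; linarith
      _ = _ := mul_one _
  linarith

/-- The lower bound half of Mertens' second theorem for the primes congruent to `1` modulo `d`. -/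
theorem exists_log_log_le_sum_one_div_prime (d : ℕ) [NeZero d] :
    ∃ C : ℝ, ∀ z : ℕ, 3 ≤ z →
      (d.totient : ℝ)⁻¹ * Real.log (Real.log z) - C ≤
        ∑ p ∈ (Finset.range (z + 1)).filter (fun p : ℕ => p.Prime ∧ (p : ZMod d) = 1),
          1 / (p : ℝ) := by
  obtain ⟨C₁, hC₁⟩ := exists_log_log_le_sum_residueClass d
  obtain ⟨C₂, hC₂0, hC₂⟩ := exists_sum_vonMangoldt_le
  have hnp := ArithmeticFunction.vonMangoldt.summable_residueClass_non_primes_div (1 : ZMod d)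
  set f := ArithmeticFunction.vonMangoldt.residueClass (1 : ZMod d) with hf
  have hf0 : ∀ n, 0 ≤ f n := ArithmeticFunction.vonMangoldt.residueClass_nonneg _
  have hfle : ∀ n, f n ≤ ArithmeticFunction.vonMangoldt n :=
    ArithmeticFunction.vonMangoldt.residueClass_le _
  set S := ∑' n : ℕ, (if n.Prime then 0 else f n) / (n : ℝ) with hS
  refine ⟨C₁ + S / Real.log 2 + 1 + C₂, fun z hz => ?_⟩
  obtain ⟨hδ, hδ1, hlog⟩ := one_div_log_natCast_bounds hz
  set δ := 1 / Real.log z with hδdef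
  obtain ⟨X, hX⟩ := hC₁ (1 + δ) (by linarith) (by linarith)
  obtain ⟨hs, hb⟩ := hC₂ (1 + δ) (by linarith) (by linarith)
  have hl2 : 0 < Real.log 2 := Real.log_pos one_lt_two
  -- Each term is charged to the primes up to `z`, to the proper prime powers, or to the range `n > z`,
  -- where `1 / log n ≤ δ`.
  have hterm : ∀ n : ℕ, f n / Real.log n / (n : ℝ) ^ (1 + δ) ≤
      (if n ∈ (Finset.range (z + 1)).filter (fun p : ℕ => p.Prime ∧ (p : ZMod d) = 1)
        then 1 / (n : ℝ) else 0)
      + (if n.Prime then 0 else f n) / (n : ℝ) / Real.log 2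
      + δ * (ArithmeticFunction.vonMangoldt n / (n : ℝ) ^ (1 + δ)) := by
    intro n
    have hA : 0 ≤ (if n ∈ (Finset.range (z + 1)).filter (fun p : ℕ => p.Prime ∧ (p : ZMod d) = 1)
        then 1 / (n : ℝ) else 0) := by positivity
    have hB : 0 ≤ (if n.Prime then 0 else f n) / (n : ℝ) / Real.log 2 := by
      have := hf0 n
      split_ifs <;> positivity
    have hD : 0 ≤ δ * (ArithmeticFunction.vonMangoldt n / (n : ℝ) ^ (1 + δ)) := by
      have := ArithmeticFunction.vonMangoldt_nonneg (n := n)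
      positivity
    by_cases hfn : f n = 0
    · rw [hfn]
      simp only [zero_div]
      have : (0 : ℝ) ≤ (if n.Prime then 0 else f n) / (n : ℝ) / Real.log 2 := hB
      rw [hfn] at this
      linarith
    have hcong : (n : ZMod d) = 1 := by
      by_contra h
      refine hfn ?_
      rw [hf, ArithmeticFunction.vonMangoldt.residueClass, Set.indicator_apply, if_neg]
      exact h
    have hn2 : 2 ≤ n := by
      by_contra h
      apply hfn
      refine le_antisymm ((hfle n).trans ?_) (hf0 n)
      interval_cases n <;> simp
    have hn1 : (1 : ℝ) < n := by exact_mod_cast hn2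
    have hn0 : (0 : ℝ) < n := by linarith
    have hln : 0 < Real.log n := Real.log_pos hn1
    have hpow : (n : ℝ) ≤ (n : ℝ) ^ (1 + δ) := by
      conv_lhs => rw [← Real.rpow_one (n : ℝ)]
      exact Real.rpow_le_rpow_of_exponent_le hn1.le (by linarith)
    by_cases hp : n.Prime
    · by_cases hnz : n ≤ z
      · have : f n / Real.log n / (n : ℝ) ^ (1 + δ) ≤ 1 / n := by
          have h1 : f n / Real.log n ≤ 1 := by
            rw [div_le_one hln]
            exact (hfle n).trans ArithmeticFunction.vonMangoldt_le_log
          exact div_le_div₀ zero_le_one h1 hn0 hpow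
        rw [if_pos (by simp [hp, hcong]; omega)]
        linarith
      · have h1 : 1 / Real.log n ≤ δ := by
          rw [hδdef]
          apply one_div_le_one_div_of_le (by linarith)
          exact Real.log_le_log (by positivity) (by exact_mod_cast (by omega : z ≤ n))
        have h2 : f n / Real.log n / (n : ℝ) ^ (1 + δ) ≤
            δ * (ArithmeticFunction.vonMangoldt n / (n : ℝ) ^ (1 + δ)) := by
          rw [← mul_div_assoc, div_eq_mul_one_div (f n), mul_comm (f n)]
          refine div_le_div_of_nonneg_right ?_ (by positivity)
          exact mul_le_mul h1 (hfle n) (hf0 n) hδ.le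
        linarith
    · have h2 : f n / Real.log n / (n : ℝ) ^ (1 + δ) ≤
          (if n.Prime then 0 else f n) / (n : ℝ) / Real.log 2 := by
        rw [if_neg hp, div_div, div_div, mul_comm (n : ℝ)]
        have : Real.log 2 ≤ Real.log n := Real.log_le_log two_pos (by exact_mod_cast hn2)
        have := hf0 n
        gcongr
      linarith
  have hsum := Finset.sum_le_sum fun n (_ : n ∈ Finset.range X) => hterm n
  rw [Finset.sum_add_distrib, Finset.sum_add_distrib, ← Finset.mul_sum, ← Finset.sum_div] at hsum
  have hT1 : (∑ n ∈ Finset.range X,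
      if n ∈ (Finset.range (z + 1)).filter (fun p : ℕ => p.Prime ∧ (p : ZMod d) = 1)
        then 1 / (n : ℝ) else 0) ≤
      ∑ p ∈ (Finset.range (z + 1)).filter (fun p : ℕ => p.Prime ∧ (p : ZMod d) = 1),
          1 / (p : ℝ) := by
    rw [← Finset.sum_filter]
    refine Finset.sum_le_sum_of_subset_of_nonneg ?_ fun _ _ _ => by positivity
    intro n hn
    exact (Finset.mem_filter.mp hn).2
  have hT2 : (∑ n ∈ Finset.range X, (if n.Prime then 0 else f n) / (n : ℝ)) / Real.log 2 ≤
      S / Real.log 2 := by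
    gcongr
    refine hnp.sum_le_tsum _ fun n _ => ?_
    have := hf0 n
    split_ifs <;> positivity
  have hT3 : δ * ∑ n ∈ Finset.range X,
      ArithmeticFunction.vonMangoldt n / (n : ℝ) ^ (1 + δ) ≤ 1 + C₂ := by
    have h1 : ∑ n ∈ Finset.range X,
        ArithmeticFunction.vonMangoldt n / (n : ℝ) ^ (1 + δ) ≤ 1 / δ + C₂ := by
      refine (hs.sum_le_tsum _ fun n _ => ?_).trans (by simpa using hb)
      exact div_nonneg ArithmeticFunction.vonMangoldt_nonneg (by positivity)
    calc _ ≤ δ * (1 / δ + C₂) := by gcongr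
      _ = 1 + δ * C₂ := by field_simp
      _ ≤ 1 + C₂ := by nlinarith
  have hlogδ : Real.log (1 / (1 + δ - 1)) = Real.log (Real.log z) := by
    rw [hδdef]; simp
  rw [hlogδ] at hX
  linarith

/-! ### Counting residues in a box -/

/-- The number of integers in `[c, c + N)` that reduce to `t` modulo `M`. -/
noncomputable def residueCount (c : ℤ) (N M : ℕ) (t : ZMod M) : ℕ :=
  ((Finset.Ico c (c + N)).filter fun n : ℤ => (n : ZMod M) = t).card

theorem residueCount_bounds (c : ℤ) (N M : ℕ) [NeZero M] (t : ZMod M) :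
    N / M ≤ residueCount c N M t ∧ residueCount c N M t ≤ N / M + 1 := by
  have hM : 0 < (M : ℤ) := by exact_mod_cast Nat.pos_of_neZero M
  have hMq : 0 < (M : ℚ) := by exact_mod_cast Nat.pos_of_neZero M
  have hfil : (Finset.Ico c (c + N)).filter (fun n : ℤ => (n : ZMod M) = t) =
      (Finset.Ico c (c + N)).filter (fun n : ℤ => n ≡ (t.val : ℤ) [ZMOD M]) := by
    refine Finset.filter_congr fun n _ => ?_
    rw [← ZMod.intCast_eq_intCast_iff]
    simp
  have hcard := Int.Ico_filter_modEq_card c (c + N) (r := M) hM t.val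
  rw [← hfil] at hcard
  change ((residueCount c N M t : ℕ) : ℤ) = _ at hcard
  set x : ℚ := ((c : ℚ) - t.val) / M with hx
  have hxy : (((c + N : ℤ) : ℚ) - ((t.val : ℤ) : ℚ)) / ((M : ℤ) : ℚ) = x + (N : ℚ) / M := by
    rw [hx]; push_cast; ring
  have hx' : ((c : ℚ) - ((t.val : ℤ) : ℚ)) / ((M : ℤ) : ℚ) = x := by
    rw [hx]; push_cast; ring
  rw [hxy, hx'] at hcard
  have hk : ((N / M : ℕ) : ℚ) ≤ (N : ℚ) / M := Nat.cast_div_le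
  have hk2 : (N : ℚ) / M < ((N / M : ℕ) : ℚ) + 1 := by
    rw [div_lt_iff₀ hMq]
    exact_mod_cast Nat.lt_mul_of_div_lt (Nat.lt_succ_self _) (Nat.pos_of_neZero M)
  constructor
  · zify
    rw [hcard]
    refine le_max_of_le_left ?_
    have : ⌈x⌉ + ((N / M : ℕ) : ℤ) ≤ ⌈x + (N : ℚ) / M⌉ := by
      rw [← Int.ceil_add_natCast]
      exact Int.ceil_mono (by linarith)
    push_cast at this
    linarith
  · zify
    rw [hcard]
    refine max_le ?_ (by positivity)
    have : ⌈x + (N : ℚ) / M⌉ ≤ ⌈x⌉ + ((N / M + 1 : ℕ) : ℤ) := by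
      rw [← Int.ceil_add_natCast]
      refine Int.ceil_mono ?_
      push_cast at *
      linarith
    push_cast at this
    linarith

theorem sum_residueCount (c : ℤ) (N M : ℕ) [NeZero M] :
    ∑ t : ZMod M, residueCount c N M t = N := by
  have := Finset.card_eq_sum_card_fiberwise (s := Finset.Ico c (c + N)) (t := Finset.univ)
    (f := fun n : ℤ => (n : ZMod M)) (fun _ _ => by simp)
  simp only [Int.card_Ico, add_sub_cancel_left, Int.toNat_natCast] at this
  exact this.symm

/-- The integer points of the cube `[c, c + N)³`. -/
noncomputable def cube (c : ℤ) (N : ℕ) : Finset (Fin 3 → ℤ) :=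
  Fintype.piFinset fun _ => Finset.Ico c (c + N)

theorem sum_cube_eq (c : ℤ) (N M : ℕ) [NeZero M] (G : (Fin 3 → ZMod M) → ℝ) :
    ∑ a ∈ cube c N, G (fun j => (a j : ZMod M)) =
      ∑ x : Fin 3 → ZMod M, G x * ∏ j, (residueCount c N M (x j) : ℝ) := by
  rw [← Finset.sum_fiberwise (cube c N) (fun a j => (a j : ZMod M))]
  refine Finset.sum_congr rfl fun x _ => ?_
  rw [Finset.sum_congr rfl (g := fun _ => G x) fun a ha => by rw [(Finset.mem_filter.mp ha).2],
    Finset.sum_const, nsmul_eq_mul, mul_comm]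
  congr 1
  have : (cube c N).filter (fun a => (fun j => (a j : ZMod M)) = x) =
      Fintype.piFinset fun j => (Finset.Ico c (c + N)).filter fun n : ℤ => (n : ZMod M) = x j := by
    ext a
    simp only [cube, Finset.mem_filter, Fintype.mem_piFinset, funext_iff]
    exact ⟨fun h j => ⟨h.1 j, h.2 j⟩, fun h => ⟨fun j => (h j).1, fun j => (h j).2⟩⟩
  rw [this, Fintype.card_piFinset]
  push_cast
  rfl

/-- Summing a nonnegative function on residues over a cube of side `N ≥ M` gives at most `8` times the
expected value; the power of `M` is kept on the left to avoid a division. -/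
theorem sum_cube_le (c : ℤ) (N M : ℕ) [NeZero M] (hMN : M ≤ N) (G : (Fin 3 → ZMod M) → ℝ)
    (hG : ∀ x, 0 ≤ G x) :
    (M : ℝ) ^ 3 * ∑ a ∈ cube c N, G (fun j => (a j : ZMod M)) ≤ 8 * (N : ℝ) ^ 3 * ∑ x, G x := by
  have hM : (0 : ℝ) < M := by exact_mod_cast Nat.pos_of_neZero M
  rw [sum_cube_eq, Finset.mul_sum, Finset.mul_sum]
  refine Finset.sum_le_sum fun x _ => ?_
  have hc : ∀ j, (M : ℝ) * residueCount c N M (x j) ≤ 2 * N := by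
    intro j
    have h1 := (residueCount_bounds c N M (x j)).2
    have h2 : M * residueCount c N M (x j) ≤ 2 * N := by
      calc M * residueCount c N M (x j) ≤ M * (N / M + 1) := Nat.mul_le_mul_left _ h1
        _ = M * (N / M) + M := by ring
        _ ≤ N + N := Nat.add_le_add (Nat.mul_div_le _ _) hMN
        _ = 2 * N := by ring
    exact_mod_cast h2
  have : ∏ j, ((M : ℝ) * residueCount c N M (x j)) ≤ ∏ _j : Fin 3, (2 * (N : ℝ)) :=
    Finset.prod_le_prod (fun j _ => by positivity) fun j _ => hc j
  rw [Finset.prod_mul_distrib] at this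
  simp only [Finset.prod_const, Finset.card_univ, Fintype.card_fin] at this
  calc (M : ℝ) ^ 3 * (G x * ∏ j, (residueCount c N M (x j) : ℝ))
      = G x * ((M : ℝ) ^ 3 * ∏ j, (residueCount c N M (x j) : ℝ)) := by ring
    _ ≤ G x * (2 * (N : ℝ)) ^ 3 := by gcongr; exact hG x
    _ = _ := by ring

/-- A bounded function of mean zero on residues modulo `M` has a small sum over a cube of side `N`: after
the common lower bound `⌊N / M⌋ ^ 3` for the number of times a residue is hit is subtracted, only a
boundary layer remains. -/
theorem abs_sum_cube_le (c : ℤ) (N M : ℕ) [NeZero M] (G : (Fin 3 → ZMod M) → ℝ)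
    (hG : ∀ x, |G x| ≤ 1) (hG0 : ∑ x, G x = 0) :
    |∑ a ∈ cube c N, G (fun j => (a j : ZMod M))| ≤ 3 * (N : ℝ) ^ 2 * M := by
  set k : ℝ := ((N / M : ℕ) : ℝ) with hk
  have hk0 : 0 ≤ k := by positivity
  have hkM : k * M ≤ N := by
    rw [hk]; exact_mod_cast Nat.div_mul_le_self N M
  have hkM2 : (N : ℝ) ≤ k * M + M := by
    have := (Nat.lt_mul_of_div_lt (Nat.lt_succ_self (N / M)) (Nat.pos_of_neZero M)).le
    rw [Nat.succ_mul] at this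
    rw [hk]; exact_mod_cast this
  have hprod : ∀ x : Fin 3 → ZMod M, k ^ 3 ≤ ∏ j, (residueCount c N M (x j) : ℝ) := by
    intro x
    have := Finset.prod_le_prod (s := Finset.univ) (f := fun _ : Fin 3 => k)
      (g := fun j => (residueCount c N M (x j) : ℝ)) (fun _ _ => hk0)
      fun j _ => by rw [hk]; exact_mod_cast (residueCount_bounds c N M (x j)).1
    simpa using this
  have htot : ∑ x : Fin 3 → ZMod M, ∏ j, (residueCount c N M (x j) : ℝ) = (N : ℝ) ^ 3 := by
    have := Finset.prod_univ_sum (fun _ : Fin 3 => (Finset.univ : Finset (ZMod M)))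
      fun _ t => (residueCount c N M t : ℝ)
    rw [Fintype.piFinset_univ] at this
    rw [← this]
    have h := sum_residueCount c N M
    simp only [Finset.prod_const, Finset.card_univ, Fintype.card_fin]
    rw [← Nat.cast_sum, h]
  have hcard : ((Finset.univ : Finset (Fin 3 → ZMod M)).card : ℝ) = (M : ℝ) ^ 3 := by
    simp [ZMod.card]
  rw [sum_cube_eq]
  have e1 : ∑ x : Fin 3 → ZMod M, G x * ∏ j, (residueCount c N M (x j) : ℝ) =
      ∑ x : Fin 3 → ZMod M, G x * (∏ j, (residueCount c N M (x j) : ℝ) - k ^ 3) := by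
    simp only [mul_sub, Finset.sum_sub_distrib]
    rw [← Finset.sum_mul, hG0]
    ring
  rw [e1]
  calc |∑ x : Fin 3 → ZMod M, G x * (∏ j, (residueCount c N M (x j) : ℝ) - k ^ 3)|
      ≤ ∑ x : Fin 3 → ZMod M, |G x * (∏ j, (residueCount c N M (x j) : ℝ) - k ^ 3)| :=
        Finset.abs_sum_le_sum_abs _ _
    _ ≤ ∑ x : Fin 3 → ZMod M, (∏ j, (residueCount c N M (x j) : ℝ) - k ^ 3) := by
        refine Finset.sum_le_sum fun x _ => ?_
        have h := sub_nonneg.mpr (hprod x)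
        rw [abs_mul, abs_of_nonneg h]
        exact mul_le_of_le_one_left h (hG x)
    _ = (N : ℝ) ^ 3 - (k * M) ^ 3 := by
        rw [Finset.sum_sub_distrib, htot, Finset.sum_const, nsmul_eq_mul, hcard]
        ring
    _ = (N - k * M) * ((N : ℝ) ^ 2 + N * (k * M) + (k * M) ^ 2) := by ring
    _ ≤ M * ((N : ℝ) ^ 2 + N * N + (N : ℝ) ^ 2) := by
        have : 0 ≤ k * M := by positivity
        gcongr
        linarith
    _ = _ := by ring

/-! ### The upper bound sieve -/

/-- Independence of the reductions modulo pairwise coprime moduli. -/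
theorem sum_prod_castHom {κ : Type*} [Fintype κ] (m : κ → ℕ) [∀ i, NeZero (m i)]
    [NeZero (∏ i, m i)] (hm : Pairwise (Function.onFun Nat.Coprime m))
    (g : ∀ i, (Fin 3 → ZMod (m i)) → ℝ) :
    ∑ x : Fin 3 → ZMod (∏ i, m i), ∏ i, g i (fun j =>
        ZMod.castHom (Finset.dvd_prod_of_mem m (Finset.mem_univ i)) (ZMod (m i)) (x j)) =
      ∏ i, ∑ y, g i y := by
  classical
  rw [Finset.prod_univ_sum, Fintype.piFinset_univ]
  refine Fintype.sum_equiv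
    ((Equiv.piCongrRight fun _ => (ZMod.prodEquivPi m hm).toEquiv).trans
      (Equiv.piComm fun _ i => ZMod (m i))) _ _ fun x => ?_
  refine Finset.prod_congr rfl fun i _ => congrArg _ (funext fun j => ?_)
  exact (ZMod.prodEquivPi_apply m hm (x j) i).symm

/-- The odds `ω / (1 - ω)` that a triple of residues modulo `m` lies in `Ω`, where `ω` is the density of
`Ω`. -/
noncomputable def sieveOdds {m : ℕ} (Ω : Finset (Fin 3 → ZMod m)) : ℝ :=
  Ω.card / ((m : ℝ) ^ 3 - Ω.card)

open scoped Classical in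
/-- The mean-zero function on triples of residues that is `-1` on `Ω` and constant off `Ω`. It is scaled
to be bounded by `1` as soon as `Ω` has density at most `1 / 2`. -/
noncomputable def sieveFactor {m : ℕ} (Ω : Finset (Fin 3 → ZMod m)) (x : Fin 3 → ZMod m) : ℝ :=
  if x ∈ Ω then -1 else sieveOdds Ω

section local_factor

variable {m : ℕ} [NeZero m] (Ω : Finset (Fin 3 → ZMod m))

theorem cube_sub_card_pos (hΩ : 2 * (Ω.card : ℝ) ≤ (m : ℝ) ^ 3) : 0 < (m : ℝ) ^ 3 - Ω.card := by
  have : (0 : ℝ) < (m : ℝ) ^ 3 := by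
    have : (0 : ℝ) < m := by exact_mod_cast Nat.pos_of_neZero m
    positivity
  linarith

theorem sieveOdds_nonneg (hΩ : 2 * (Ω.card : ℝ) ≤ (m : ℝ) ^ 3) : 0 ≤ sieveOdds Ω :=
  div_nonneg (by positivity) (cube_sub_card_pos Ω hΩ).le

theorem sieveOdds_le_one (hΩ : 2 * (Ω.card : ℝ) ≤ (m : ℝ) ^ 3) : sieveOdds Ω ≤ 1 := by
  rw [sieveOdds, div_le_one (cube_sub_card_pos Ω hΩ)]
  linarith

theorem abs_sieveFactor_le (hΩ : 2 * (Ω.card : ℝ) ≤ (m : ℝ) ^ 3) (x : Fin 3 → ZMod m) :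
    |sieveFactor Ω x| ≤ 1 := by
  rw [sieveFactor]
  split_ifs
  · simp
  · rw [abs_of_nonneg (sieveOdds_nonneg Ω hΩ)]
    exact sieveOdds_le_one Ω hΩ

theorem sum_ite_mem_cube (u v : ℝ) [DecidablePred (· ∈ Ω)] :
    ∑ x, (if x ∈ Ω then u else v) = Ω.card * u + ((m : ℝ) ^ 3 - Ω.card) * v := by
  have hc : ((Finset.univ : Finset (Fin 3 → ZMod m)).card : ℝ) = (m : ℝ) ^ 3 := by
    simp [ZMod.card]
  rw [← Finset.sum_add_sum_compl Ω, Finset.sum_congr rfl fun x hx => if_pos hx,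
    Finset.sum_congr (rfl : Ωᶜ = Ωᶜ) fun x hx => if_neg (Finset.mem_compl.mp hx),
    Finset.sum_const, Finset.sum_const, nsmul_eq_mul, nsmul_eq_mul, Finset.card_compl,
    Nat.cast_sub (Finset.card_le_univ _), ← Finset.card_univ, hc]

theorem sum_sieveFactor (hΩ : 2 * (Ω.card : ℝ) ≤ (m : ℝ) ^ 3) : ∑ x, sieveFactor Ω x = 0 := by
  classical
  have h := (cube_sub_card_pos Ω hΩ).ne'
  simp only [sieveFactor]
  rw [sum_ite_mem_cube, sieveOdds, mul_div_cancel₀ _ h]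
  ring

theorem sum_sieveFactor_sq (hΩ : 2 * (Ω.card : ℝ) ≤ (m : ℝ) ^ 3) :
    ∑ x, sieveFactor Ω x * sieveFactor Ω x = (m : ℝ) ^ 3 * sieveOdds Ω := by
  classical
  have h := (cube_sub_card_pos Ω hΩ).ne'
  simp only [sieveFactor, mul_ite, ite_mul]
  have e : ∀ x, (if x ∈ Ω then if x ∈ Ω then (-1 : ℝ) * -1 else sieveOdds Ω * -1
      else if x ∈ Ω then -1 * sieveOdds Ω else sieveOdds Ω * sieveOdds Ω) =
      if x ∈ Ω then 1 else sieveOdds Ω * sieveOdds Ω := by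
    intro x; split_ifs <;> ring
  simp only [e]
  rw [sum_ite_mem_cube, sieveOdds]
  field_simp
  ring

end local_factor

section sieve

variable {ι : Type*} [Fintype ι] [DecidableEq ι] (m : ι → ℕ) [∀ i, NeZero (m i)]
  (Ω : ∀ i, Finset (Fin 3 → ZMod (m i)))

/-- The product over `i ∈ T` of the local factors for `Ω i`, as a function of an integer triple. -/
noncomputable def sieveProd (T : Finset ι) (a : Fin 3 → ℤ) : ℝ :=
  ∏ i ∈ T, sieveFactor (Ω i) (fun j => (a j : ZMod (m i)))

/-- Approximate orthogonality over a cube of the functions `sieveProd`. -/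
theorem sum_cube_sieveProd_mul_le (hm : Pairwise (Function.onFun Nat.Coprime m))
    (hΩ : ∀ i, 2 * ((Ω i).card : ℝ) ≤ (m i : ℝ) ^ 3)
    (c : ℤ) {N D : ℕ} (hN : D ^ 2 ≤ N) {T T' : Finset ι}
    (hT : ∏ i ∈ T, m i ≤ D) (hT' : ∏ i ∈ T', m i ≤ D) :
    ∑ a ∈ cube c N, sieveProd m Ω T a * sieveProd m Ω T' a ≤
      (if T = T' then 8 * (N : ℝ) ^ 3 * ∏ i ∈ T, sieveOdds (Ω i) else 0)
        + 3 * (N : ℝ) ^ 2 * (D : ℝ) ^ 2 := by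
  set U := T ∪ T' with hU
  have hmpos : ∀ i, 1 ≤ m i := fun i => Nat.pos_of_neZero (m i)
  let μ : U → ℕ := fun i => m i
  have hμ : Pairwise (Function.onFun Nat.Coprime μ) := fun i j hij =>
    hm fun h => hij (Subtype.ext h)
  set M := ∏ i, μ i with hMdef
  have hMU : M = ∏ i ∈ U, m i := Finset.prod_coe_sort U m
  have hM0 : M ≠ 0 := Finset.prod_ne_zero_iff.mpr fun i _ => NeZero.ne (m i)
  have : NeZero M := ⟨hM0⟩
  have hMD : M ≤ D ^ 2 := by
    rw [hMU, sq]
    calc ∏ i ∈ U, m i ≤ (∏ i ∈ U, m i) * ∏ i ∈ T ∩ T', m i :=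
          Nat.le_mul_of_pos_right _ (Finset.prod_pos fun i _ => hmpos i)
      _ = (∏ i ∈ T, m i) * ∏ i ∈ T', m i := Finset.prod_union_inter
      _ ≤ D * D := Nat.mul_le_mul hT hT'
  -- The product of the two functions factors over `U = T ∪ T'`, with the square of the local factor at
  -- the places of `T ∩ T'` and the local factor itself, of mean zero, at the others.
  let g : ∀ i : U, (Fin 3 → ZMod (μ i)) → ℝ := fun i y =>
    (if (i : ι) ∈ T then sieveFactor (Ω i) y else 1) *
      (if (i : ι) ∈ T' then sieveFactor (Ω i) y else 1)
  let G : (Fin 3 → ZMod M) → ℝ := fun x => ∏ i, g i (fun j =>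
    ZMod.castHom (Finset.dvd_prod_of_mem μ (Finset.mem_univ i)) (ZMod (μ i)) (x j))
  have hGa : ∀ a : Fin 3 → ℤ, sieveProd m Ω T a * sieveProd m Ω T' a =
      G (fun j => (a j : ZMod M)) := by
    intro a
    have hext : ∀ R : Finset ι, R ⊆ U → sieveProd m Ω R a =
        ∏ i ∈ U, if i ∈ R then sieveFactor (Ω i) (fun j => (a j : ZMod (m i))) else 1 := by
      intro R hR
      rw [Finset.prod_ite_mem, Finset.inter_eq_right.mpr hR]
      rfl
    rw [hext T Finset.subset_union_left, hext T' Finset.subset_union_right,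
      ← Finset.prod_mul_distrib, ← Finset.prod_coe_sort]
    simp only [G, g, map_intCast]
  have hGsum : ∑ x, G x = ∏ i, ∑ y, g i y := sum_prod_castHom μ hμ g
  have hg1 : ∀ i y, |g i y| ≤ 1 := by
    intro i y
    have h := abs_sieveFactor_le (Ω i) (hΩ i) y
    simp only [g, abs_mul]
    refine mul_le_one₀ ?_ (abs_nonneg _) ?_ <;> split_ifs <;> first | exact h | simp
  have hG1 : ∀ x, |G x| ≤ 1 := by
    intro x
    simp only [G, Finset.abs_prod]
    exact Finset.prod_le_one (fun _ _ => abs_nonneg _) fun i _ => hg1 i _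
  simp only [hGa]
  have hpos3 : 0 ≤ 3 * (N : ℝ) ^ 2 * (D : ℝ) ^ 2 := by positivity
  by_cases hTT : T = T'
  · rw [if_pos hTT]
    have hUT : U = T := by rw [hU, ← hTT, Finset.union_idempotent]
    have hg : ∀ i : U, ∀ y, g i y = sieveFactor (Ω i) y * sieveFactor (Ω i) y := by
      intro i y
      have h1 : (i : ι) ∈ T := hUT ▸ i.2
      have h2 : (i : ι) ∈ T' := hTT ▸ h1
      simp only [g, if_pos h1, if_pos h2]
    have hloc : ∑ x, G x = (M : ℝ) ^ 3 * ∏ i ∈ T, sieveOdds (Ω i) := by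
      rw [hGsum]
      have : ∀ i : U, ∑ y, g i y = (m i : ℝ) ^ 3 * sieveOdds (Ω i) := by
        intro i
        simp only [hg]
        exact sum_sieveFactor_sq (Ω i) (hΩ i)
      simp only [this]
      rw [Finset.prod_coe_sort U fun i => (m i : ℝ) ^ 3 * sieveOdds (Ω i),
        Finset.prod_mul_distrib, hMU, Finset.prod_pow, hUT]
      push_cast
      rfl
    have hnonneg : ∀ x, 0 ≤ G x := fun x =>
      Finset.prod_nonneg fun i _ => by rw [hg]; exact mul_self_nonneg _
    have h := sum_cube_le c N M (hMD.trans hN) G hnonneg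
    rw [hloc, mul_left_comm] at h
    have hM3 : (0 : ℝ) < (M : ℝ) ^ 3 := by
      have : (0 : ℝ) < M := by exact_mod_cast Nat.pos_of_neZero M
      positivity
    have := le_of_mul_le_mul_left h hM3
    linarith
  · rw [if_neg hTT, zero_add]
    have hex : ∃ i, (i ∈ T ∧ i ∉ T') ∨ (i ∈ T' ∧ i ∉ T) := by
      by_contra! hcon
      exact hTT (Finset.ext fun i => ⟨fun h => (hcon i).1 h, fun h => (hcon i).2 h⟩)
    obtain ⟨i, hi⟩ := hex
    have hiU : i ∈ U := Finset.mem_union.mpr (hi.imp And.left And.left)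
    have hG0 : ∑ x, G x = 0 := by
      rw [hGsum]
      refine Finset.prod_eq_zero (Finset.mem_univ (⟨i, hiU⟩ : U)) ?_
      rw [← sum_sieveFactor (Ω i) (hΩ i)]
      refine Finset.sum_congr rfl fun y _ => ?_
      rcases hi with ⟨h1, h2⟩ | ⟨h1, h2⟩ <;> simp [g, h1, h2]
    calc _ ≤ |_| := le_abs_self _
      _ ≤ 3 * (N : ℝ) ^ 2 * M := abs_sum_cube_le c N M G hG1 hG0
      _ ≤ _ := by
        gcongr
        exact_mod_cast hMD

/-- **Selberg's upper bound sieve** in a cube: `S` avoids the classes `Ω i` for all `i`, and `𝒯` is the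
set of index sets over which the sieve function is summed. -/
theorem card_sifted_le (hm : Pairwise (Function.onFun Nat.Coprime m))
    (hΩ : ∀ i, 2 * ((Ω i).card : ℝ) ≤ (m i : ℝ) ^ 3)
    (c : ℤ) {N D : ℕ} (hN : D ^ 2 ≤ N) (𝒯 : Finset (Finset ι))
    (h𝒯 : ∀ T ∈ 𝒯, ∏ i ∈ T, m i ≤ D) (S : Finset (Fin 3 → ℤ)) (hS : S ⊆ cube c N)
    (hSΩ : ∀ a ∈ S, ∀ i, (fun j => (a j : ZMod (m i))) ∉ Ω i)
    {L : ℝ} (hL : 1 ≤ L) (hLeq : L = ∑ T ∈ 𝒯, ∏ i ∈ T, sieveOdds (Ω i)) :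
    (S.card : ℝ) ≤ 8 * (N : ℝ) ^ 3 / L + 3 * (N : ℝ) ^ 2 * (D : ℝ) ^ 2 * (𝒯.card : ℝ) ^ 2 := by
  have hSL : ∀ a ∈ S, ∑ T ∈ 𝒯, sieveProd m Ω T a = L := by
    intro a ha
    rw [hLeq]
    refine Finset.sum_congr rfl fun T _ => Finset.prod_congr rfl fun i _ => ?_
    rw [sieveFactor, if_neg (hSΩ a ha i)]
  have hmain : (S.card : ℝ) * L ^ 2 ≤
      8 * (N : ℝ) ^ 3 * L + 3 * (N : ℝ) ^ 2 * (D : ℝ) ^ 2 * (𝒯.card : ℝ) ^ 2 := by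
    calc (S.card : ℝ) * L ^ 2 = ∑ a ∈ S, (∑ T ∈ 𝒯, sieveProd m Ω T a) ^ 2 := by
          rw [Finset.sum_congr rfl fun a ha => by rw [hSL a ha], Finset.sum_const, nsmul_eq_mul]
      _ ≤ ∑ a ∈ cube c N, (∑ T ∈ 𝒯, sieveProd m Ω T a) ^ 2 :=
          Finset.sum_le_sum_of_subset_of_nonneg hS fun _ _ _ => sq_nonneg _
      _ = ∑ T ∈ 𝒯, ∑ T' ∈ 𝒯, ∑ a ∈ cube c N, sieveProd m Ω T a * sieveProd m Ω T' a := by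
          simp only [sq, Finset.sum_mul_sum]
          rw [Finset.sum_comm]
          exact Finset.sum_congr rfl fun T _ => Finset.sum_comm
      _ ≤ ∑ T ∈ 𝒯, ∑ T' ∈ 𝒯, ((if T = T' then 8 * (N : ℝ) ^ 3 * ∏ i ∈ T, sieveOdds (Ω i) else 0)
            + 3 * (N : ℝ) ^ 2 * (D : ℝ) ^ 2) :=
          Finset.sum_le_sum fun T hT => Finset.sum_le_sum fun T' hT' =>
            sum_cube_sieveProd_mul_le m Ω hm hΩ c hN (h𝒯 T hT) (h𝒯 T' hT')
      _ = _ := by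
          simp only [Finset.sum_add_distrib, Finset.sum_const, nsmul_eq_mul, Finset.sum_ite_eq]
          rw [Finset.sum_ite_mem, Finset.inter_self, ← Finset.mul_sum, ← hLeq]
          ring
  have hL0 : 0 < L := by linarith
  have hE : 0 ≤ 3 * (N : ℝ) ^ 2 * (D : ℝ) ^ 2 * (𝒯.card : ℝ) ^ 2 := by positivity
  have h1 : (S.card : ℝ) ≤ (8 * (N : ℝ) ^ 3 * L +
      3 * (N : ℝ) ^ 2 * (D : ℝ) ^ 2 * (𝒯.card : ℝ) ^ 2) / L ^ 2 := by
    rwa [le_div_iff₀ (by positivity)]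
  refine h1.trans ?_
  rw [add_div]
  refine add_le_add (le_of_eq (by field_simp)) (div_le_self hE (by nlinarith))

end sieve

/-- The unnormalised expectation of the total weight of a random set `T ⊆ P` chosen with probability
proportional to `∏ i ∈ T, h i`. -/
theorem sum_powerset_weight_le {ι : Type*} [DecidableEq ι] (P : Finset ι) (h w : ι → ℝ)
    (hh : ∀ i, 0 ≤ h i) (hw : ∀ i, 0 ≤ w i) :
    ∑ T ∈ P.powerset, (∑ i ∈ T, w i) * ∏ i ∈ T, h i ≤
      (∑ i ∈ P, w i * h i) * ∏ i ∈ P, (1 + h i) := by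
  induction P using Finset.induction_on with
  | empty => simp
  | insert a P ha ih =>
    have hins : ∀ T ∈ P.powerset, (∑ i ∈ insert a T, w i) * ∏ i ∈ insert a T, h i =
        w a * h a * ∏ i ∈ T, h i + h a * ((∑ i ∈ T, w i) * ∏ i ∈ T, h i) := by
      intro T hT
      have haT : a ∉ T := fun h => ha (Finset.mem_powerset.mp hT h)
      rw [Finset.sum_insert haT, Finset.prod_insert haT]
      ring
    rw [Finset.sum_powerset_insert ha, Finset.sum_congr rfl hins, Finset.sum_add_distrib,
      ← Finset.mul_sum, ← Finset.mul_sum, ← Finset.prod_one_add, Finset.sum_insert ha,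
      Finset.prod_insert ha]
    set E := ∑ T ∈ P.powerset, (∑ i ∈ T, w i) * ∏ i ∈ T, h i
    set Z := ∏ i ∈ P, (1 + h i) with hZ
    set B := ∑ i ∈ P, w i * h i
    have hZ0 : 0 ≤ Z := Finset.prod_nonneg fun i _ => by linarith [hh i]
    have h1 : 0 ≤ w a * h a * (h a * Z) :=
      mul_nonneg (mul_nonneg (hw a) (hh a)) (mul_nonneg (hh a) hZ0)
    nlinarith [mul_le_mul_of_nonneg_left ih (hh a)]

/-- Markov's inequality: sets of weight at most twice the bound `W` for the expected weight carry at least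
half of the total mass. -/
theorem half_prod_le_sum_truncated {ι : Type*} [DecidableEq ι] (P : Finset ι) (h w : ι → ℝ)
    (hh : ∀ i, 0 ≤ h i) (hw : ∀ i, 0 ≤ w i) {W : ℝ} (hW0 : 0 < W)
    (hW : ∑ i ∈ P, w i * h i ≤ W) :
    (∏ i ∈ P, (1 + h i)) / 2 ≤
      ∑ T ∈ P.powerset with ∑ i ∈ T, w i ≤ 2 * W, ∏ i ∈ T, h i := by
  have hT0 : ∀ T : Finset ι, 0 ≤ ∏ i ∈ T, h i := fun T => Finset.prod_nonneg fun i _ => hh i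
  set Z := ∏ i ∈ P, (1 + h i) with hZ
  have hZ0 : 0 ≤ Z := Finset.prod_nonneg fun i _ => by linarith [hh i]
  have hsplit := Finset.sum_filter_add_sum_filter_not P.powerset
    (fun T => ∑ i ∈ T, w i ≤ 2 * W) fun T => ∏ i ∈ T, h i
  rw [← Finset.prod_one_add, ← hZ] at hsplit
  set X := ∑ T ∈ P.powerset with ¬ ∑ i ∈ T, w i ≤ 2 * W, ∏ i ∈ T, h i with hX
  have hbad : 2 * W * X ≤ W * Z := by
    calc _ = ∑ T ∈ P.powerset with ¬ ∑ i ∈ T, w i ≤ 2 * W, 2 * W * ∏ i ∈ T, h i :=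
          Finset.mul_sum _ _ _
      _ ≤ ∑ T ∈ P.powerset with ¬ ∑ i ∈ T, w i ≤ 2 * W, (∑ i ∈ T, w i) * ∏ i ∈ T, h i := by
          refine Finset.sum_le_sum fun T hT => ?_
          exact mul_le_mul_of_nonneg_right (not_le.mp (Finset.mem_filter.mp hT).2).le (hT0 T)
      _ ≤ ∑ T ∈ P.powerset, (∑ i ∈ T, w i) * ∏ i ∈ T, h i :=
          Finset.sum_le_sum_of_subset_of_nonneg (Finset.filter_subset _ _) fun T _ _ =>
            mul_nonneg (Finset.sum_nonneg fun i _ => hw i) (hT0 T)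
      _ ≤ (∑ i ∈ P, w i * h i) * Z := sum_powerset_weight_le P h w hh hw
      _ ≤ W * Z := by gcongr
  have : X ≤ Z / 2 := by
    rw [mul_comm 2 W, mul_assoc W 2] at hbad
    linarith [le_of_mul_le_mul_left hbad hW0]
  linarith

/-! ### The local obstruction at a prime -/

/-- The pairs `(r, s)` of residues for which `r t ^ d + s u ^ d = 0` has only the trivial solution. -/
def IsAnisotropic {F : Type*} [Field F] (d : ℕ) (r s : F) : Prop :=
  ∀ t u : F, r * t ^ d + s * u ^ d = 0 → t = 0 ∧ u = 0

section

variable (p : ℕ) [Fact p.Prime]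

/-- Reduction `ℤ / p² → ℤ / p`. -/
def reduceSq : ZMod (p ^ 2) →+* ZMod p :=
  ZMod.castHom (Dvd.intro_left (p ^ 1) (by ring)) (ZMod p)

open scoped Classical in
/-- The triples modulo `p ^ 2` whose `i`-th coordinate is divisible by `p` exactly once, and whose two
other coordinates form an anisotropic pair modulo `p`. Indices are read cyclically in `Fin 3`. -/
noncomputable def obstructedAt (d : ℕ) (i : Fin 3) : Finset (Fin 3 → ZMod (p ^ 2)) :=
  Finset.univ.filter fun x => reduceSq p (x i) = 0 ∧ x i ≠ 0 ∧
    IsAnisotropic d (reduceSq p (x (i + 1))) (reduceSq p (x (i + 2)))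

open scoped Classical in
/-- The triples modulo `p ^ 2` that are obstructed at one of their coordinates. -/
noncomputable def obstructed (d : ℕ) : Finset (Fin 3 → ZMod (p ^ 2)) :=
  Finset.univ.biUnion fun i => obstructedAt p d i

theorem card_fiber_reduceSq (r : ZMod p) :
    ((Finset.univ : Finset (ZMod (p ^ 2))).filter fun x => reduceSq p x = r).card = p := by
  have hp : 0 < p := (Fact.out : p.Prime).pos
  have hsurj : Function.Surjective (reduceSq p) := ZMod.ringHom_surjective _
  have hconst : ∀ s : ZMod p,
      ((Finset.univ : Finset (ZMod (p ^ 2))).filter fun x => reduceSq p x = s).card =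
      ((Finset.univ : Finset (ZMod (p ^ 2))).filter fun x => reduceSq p x = r).card := fun s =>
    AddMonoidHom.card_fiber_eq_of_mem_range (reduceSq p) (hsurj s) (hsurj r)
  have := Finset.card_eq_sum_card_fiberwise (s := (Finset.univ : Finset (ZMod (p ^ 2))))
    (t := Finset.univ) (f := reduceSq p) (fun _ _ => by simp)
  simp only [hconst, Finset.sum_const, Finset.card_univ, ZMod.card, smul_eq_mul] at this
  exact (Nat.eq_of_mul_eq_mul_left hp ((sq p).symm.trans this)).symm

theorem card_fiber_reduceSq_prod (R : ZMod p → ZMod p → Prop) [∀ r s, Decidable (R r s)] :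
    ((Finset.univ : Finset (ZMod (p ^ 2) × ZMod (p ^ 2))).filter
        fun x => R (reduceSq p x.1) (reduceSq p x.2)).card =
      p ^ 2 * ((Finset.univ : Finset (ZMod p × ZMod p)).filter fun x => R x.1 x.2).card := by
  rw [Finset.card_eq_sum_card_fiberwise
    (t := (Finset.univ : Finset (ZMod p × ZMod p)).filter fun x => R x.1 x.2)
    (f := fun x => (reduceSq p x.1, reduceSq p x.2)) (fun x hx => by simpa using hx)]
  rw [Finset.sum_const_nat (m := p ^ 2) fun y hy => ?_, mul_comm]
  have : (((Finset.univ : Finset (ZMod (p ^ 2) × ZMod (p ^ 2))).filter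
      fun x => R (reduceSq p x.1) (reduceSq p x.2)).filter
        fun x => (reduceSq p x.1, reduceSq p x.2) = y) =
      (Finset.univ.filter fun x => reduceSq p x = y.1) ×ˢ
        (Finset.univ.filter fun x => reduceSq p x = y.2) := by
    ext x
    simp only [Finset.mem_filter, Finset.mem_univ, true_and, Finset.mem_product, Prod.ext_iff]
    refine ⟨fun h => h.2, fun h => ⟨?_, h⟩⟩
    rw [h.1, h.2]
    exact (Finset.mem_filter.mp hy).2
  rw [this, Finset.card_product, card_fiber_reduceSq, card_fiber_reduceSq, sq]

variable {p}

theorem IsAnisotropic.ne_zero {F : Type*} [Field F] {d : ℕ} (hd : d ≠ 0) {r s : F}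
    (h : IsAnisotropic d r s) : r ≠ 0 ∧ s ≠ 0 := by
  refine ⟨fun hr => ?_, fun hs => ?_⟩
  · exact one_ne_zero (h 1 0 (by simp [hr, hd])).1
  · exact one_ne_zero (h 0 1 (by simp [hs, hd])).2

/-- Every pair of units is of the form `(r, -r u)`, and it is anisotropic unless `u` is a `d`-th power. -/
theorem isAnisotropic_neg_mul_iff {F : Type*} [Field F] {d : ℕ} (hd : d ≠ 0) (r u : Fˣ) :
    IsAnisotropic d (r : F) (-(r * u) : F) ↔ u ∉ (powMonoidHom d : Fˣ →* Fˣ).range := by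
  constructor
  · rintro h ⟨v, rfl⟩
    have := (h v 1 (by simp)).2
    exact one_ne_zero this
  · intro h t v htv
    have e : t ^ d = u * v ^ d := by
      have : (r : F) * (t ^ d - u * v ^ d) = 0 := by linear_combination htv
      have := (mul_eq_zero.mp this).resolve_left r.ne_zero
      linear_combination this
    by_cases hv : v = 0
    · subst hv
      rw [zero_pow hd, mul_zero] at e
      exact ⟨pow_eq_zero_iff hd |>.mp e, rfl⟩
    · have ht : t ≠ 0 := by
        rintro rfl
        rw [zero_pow hd] at e
        exact mul_ne_zero u.ne_zero (pow_ne_zero d hv) e.symm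
      exfalso
      refine h ⟨Units.mk0 t ht / Units.mk0 v hv, ?_⟩
      ext
      simp [div_pow, e, hv]

open scoped Classical in
theorem card_isAnisotropic {d : ℕ} (hd : d ≠ 0) (hdp : d ∣ p - 1) :
    (((Finset.univ : Finset (ZMod p × ZMod p)).filter fun x => IsAnisotropic d x.1 x.2).card : ℝ) =
      (p - 1 : ℝ) ^ 2 * (1 - 1 / d) := by
  have hp : p.Prime := Fact.out
  set H := (powMonoidHom d : (ZMod p)ˣ →* (ZMod p)ˣ).range with hH
  have hcard : ((Finset.univ : Finset (ZMod p × ZMod p)).filter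
      fun x => IsAnisotropic d x.1 x.2).card =
      ((Finset.univ : Finset (ZMod p)ˣ) ×ˢ
        (Finset.univ : Finset (ZMod p)ˣ).filter fun u => u ∉ H).card := by
    symm
    refine Finset.card_bij (fun x _ => ((x.1 : ZMod p), (-(x.1 * x.2) : ZMod p))) ?_ ?_ ?_
    · intro x hx
      simp only [Finset.mem_product, Finset.mem_filter, Finset.mem_univ, true_and] at hx ⊢
      exact (isAnisotropic_neg_mul_iff hd x.1 x.2).mpr hx
    · rintro ⟨r, u⟩ _ ⟨r', u'⟩ _ h
      simp only [Prod.mk.injEq, neg_inj] at h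
      obtain rfl : r = r' := Units.ext h.1
      have : u = u' := Units.ext (mul_left_cancel₀ r.ne_zero h.2)
      rw [this]
    · rintro ⟨r, s⟩ h
      simp only [Finset.mem_filter, Finset.mem_univ, true_and] at h
      obtain ⟨hr, hs⟩ := h.ne_zero hd
      have e : (-(r * (-s / r)) : ZMod p) = s := by field_simp
      have hu : -s / r ≠ 0 := div_ne_zero (neg_ne_zero.mpr hs) hr
      refine ⟨(Units.mk0 r hr, Units.mk0 _ hu), ?_, ?_⟩
      · simp only [Finset.mem_product, Finset.mem_filter, Finset.mem_univ, true_and]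
        refine (isAnisotropic_neg_mul_iff hd (Units.mk0 r hr) _).mp ?_
        simpa only [Units.val_mk0, e] using h
      · simp only [Units.val_mk0, e]
  have hunits : Nat.card (ZMod p)ˣ = p - 1 := by
    rw [Nat.card_eq_fintype_card, ZMod.card_units]
  have hidx : d * Nat.card H = p - 1 := by
    have h1 := H.card_mul_index
    rw [hH, IsCyclic.index_powMonoidHom_range, hunits, Nat.gcd_eq_right hdp, ← hH] at h1
    rw [mul_comm, h1]
  have hHc : ((Finset.univ : Finset (ZMod p)ˣ).filter fun u => u ∈ H).card = Nat.card H := by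
    rw [Nat.card_eq_fintype_card, Fintype.card_subtype]
  have hsplit := Finset.card_filter_add_card_filter_not
    (s := (Finset.univ : Finset (ZMod p)ˣ)) (fun u => u ∈ H)
  rw [hHc, Finset.card_univ, ZMod.card_units] at hsplit
  have hp1 : ((p - 1 : ℕ) : ℝ) = (p : ℝ) - 1 := by
    rw [Nat.cast_sub hp.one_le, Nat.cast_one]
  have hd0 : (d : ℝ) ≠ 0 := by exact_mod_cast hd
  rw [hcard, Finset.card_product, Finset.card_univ, ZMod.card_units]
  have e1 : (d : ℝ) * Nat.card H = p - 1 := by rw [← hp1]; exact_mod_cast hidx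
  have e2 : (Nat.card H : ℝ) + ((Finset.univ : Finset (ZMod p)ˣ).filter fun u => u ∉ H).card
      = p - 1 := by rw [← hp1]; exact_mod_cast hsplit
  have e3 : (Nat.card H : ℝ) = (p - 1) / d := by rw [← e1]; field_simp
  push_cast
  rw [hp1, eq_sub_of_add_eq' e2, e3]
  field_simp

theorem card_obstructedAt {d : ℕ} (hd : d ≠ 0) (hdp : d ∣ p - 1) (i : Fin 3) :
    ((obstructedAt p d i).card : ℝ) = (p : ℝ) ^ 2 * (p - 1) ^ 3 * (1 - 1 / d) := by
  classical
  have hp : p.Prime := Fact.out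
  have hcard : (obstructedAt p d i).card =
      (((Finset.univ : Finset (ZMod (p ^ 2))).filter fun x => reduceSq p x = 0).erase 0 ×ˢ
        (Finset.univ : Finset (ZMod (p ^ 2) × ZMod (p ^ 2))).filter
          fun x => IsAnisotropic d (reduceSq p x.1) (reduceSq p x.2)).card := by
    refine Finset.card_nbij' (fun x => (x i, x (i + 1), x (i + 2)))
      (fun y k => if k = i then y.1 else if k = i + 1 then y.2.1 else y.2.2) ?_ ?_ ?_ ?_
    · intro x hx
      simpa [obstructedAt, and_assoc, and_left_comm] using hx
    · intro y hy
      have h1 : i + 1 ≠ i := by fin_cases i <;> decide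
      have h2 : i + 2 ≠ i := by fin_cases i <;> decide
      have h3 : i + 2 ≠ i + 1 := by fin_cases i <;> decide
      simpa [obstructedAt, and_assoc, and_left_comm, h1, h2, h3] using hy
    · intro x _
      funext k
      fin_cases i <;> fin_cases k <;> rfl
    · rintro ⟨a, b, c⟩ _
      fin_cases i <;> rfl
  have hp1 : ((p - 1 : ℕ) : ℝ) = (p : ℝ) - 1 := by
    rw [Nat.cast_sub hp.one_le, Nat.cast_one]
  rw [hcard, Finset.card_product, Finset.card_erase_of_mem (by simp), card_fiber_reduceSq,
    card_fiber_reduceSq_prod p (IsAnisotropic d)]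
  push_cast
  rw [card_isAnisotropic hd hdp, hp1]
  ring

theorem card_obstructed {d : ℕ} (hd : d ≠ 0) (hdp : d ∣ p - 1) :
    ((obstructed p d).card : ℝ) = 3 * (1 - 1 / d) * (p : ℝ) ^ 2 * (p - 1) ^ 3 := by
  classical
  -- The coordinates forming an anisotropic pair are units, so the three cases are disjoint.
  have hother : ∀ i j : Fin 3, i ≠ j → ∀ x ∈ obstructedAt p d i, reduceSq p (x j) ≠ 0 := by
    intro i j hij x hx
    obtain ⟨-, -, h⟩ := (Finset.mem_filter.mp hx).2
    have := h.ne_zero hd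
    fin_cases i <;> fin_cases j <;> first | exact absurd rfl hij | exact this.1 | exact this.2
  rw [obstructed, Finset.card_biUnion]
  · push_cast
    simp only [card_obstructedAt hd hdp, Finset.sum_const, Finset.card_univ, Fintype.card_fin,
      nsmul_eq_mul]
    push_cast
    ring
  · intro i _ j _ hij
    refine Finset.disjoint_left.mpr fun x hx hx' => ?_
    exact hother i j hij x hx (Finset.mem_filter.mp hx').2.1

end

theorem FermatSoluble.exists_primitive {d : ℕ} {a : Fin 3 → ℤ}
    (h : FermatSoluble d a) : ∃ y : Fin 3 → ℤ,
      a 0 * y 0 ^ d + a 1 * y 1 ^ d + a 2 * y 2 ^ d = 0 ∧ Finset.univ.gcd y = 1 := by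
  obtain ⟨x, hx, he⟩ := h
  obtain ⟨⟨b, hb⟩, hint⟩ := IsLocalization.exist_integer_multiples_of_finset
    (nonZeroDivisors ℤ) (Finset.univ.image x)
  have hb0 : (b : ℚ) ≠ 0 := by exact_mod_cast nonZeroDivisors.ne_zero hb
  have : ∀ j, ∃ y : ℤ, (y : ℚ) = b * x j := by
    intro j
    obtain ⟨y, hy⟩ := hint (x j) (Finset.mem_image_of_mem x (Finset.mem_univ j))
    exact ⟨y, by simpa using hy⟩
  choose y hy using this
  obtain ⟨g, hg, hg1⟩ := Finset.extract_gcd y (Finset.univ_nonempty)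
  set G := Finset.univ.gcd y with hG
  refine ⟨g, ?_, hg1⟩
  have hG0 : G ≠ 0 := by
    intro h0
    apply hx
    funext j
    have h1 := hg j (Finset.mem_univ j)
    rw [h0, zero_mul] at h1
    have h2 := hy j
    rw [h1] at h2
    simpa [hb0, eq_comm] using h2
  have hyg : ∀ j, (G : ℚ) * g j = b * x j := fun j => by
    rw [← hy j, hg j (Finset.mem_univ j)]; push_cast; rfl
  have : (G : ℚ) ^ d * (a 0 * g 0 ^ d + a 1 * g 1 ^ d + a 2 * g 2 ^ d) = 0 := by
    calc _ = a 0 * ((G : ℚ) * g 0) ^ d + a 1 * ((G : ℚ) * g 1) ^ d + a 2 * ((G : ℚ) * g 2) ^ d := by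
          ring
      _ = (b : ℚ) ^ d * (a 0 * x 0 ^ d + a 1 * x 1 ^ d + a 2 * x 2 ^ d) := by
          rw [hyg, hyg, hyg]; ring
      _ = 0 := by rw [he, mul_zero]
  have := (mul_eq_zero.mp this).resolve_left (pow_ne_zero _ (by exact_mod_cast hG0))
  exact_mod_cast this

/-- The local obstruction: a soluble triple is not obstructed at any prime. -/
theorem FermatSoluble.notMem_obstructed {d : ℕ} (hd : 2 ≤ d) {a : Fin 3 → ℤ}
    (h : FermatSoluble d a) (p : ℕ) [Fact p.Prime] :
    (fun j => (a j : ZMod (p ^ 2))) ∉ obstructed p d := by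
  classical
  have hp : Prime (p : ℤ) := Nat.prime_iff_prime_int.mp Fact.out
  obtain ⟨y, hy, hgcd⟩ := h.exists_primitive
  intro hmem
  obtain ⟨i, -, hi⟩ := Finset.mem_biUnion.mp hmem
  obtain ⟨h1, h2, h3⟩ := (Finset.mem_filter.mp hi).2
  simp only [map_intCast] at h1 h3
  rw [ZMod.intCast_zmod_eq_zero_iff_dvd] at h1
  rw [Ne, ZMod.intCast_zmod_eq_zero_iff_dvd] at h2
  have hy' : a i * y i ^ d + a (i + 1) * y (i + 1) ^ d + a (i + 2) * y (i + 2) ^ d = 0 := by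
    fin_cases i
    · exact hy
    · change a 1 * y 1 ^ d + a 2 * y 2 ^ d + a 0 * y 0 ^ d = 0
      linear_combination hy
    · change a 2 * y 2 ^ d + a 0 * y 0 ^ d + a 1 * y 1 ^ d = 0
      linear_combination hy
  obtain ⟨hu, hv⟩ := h3 (y (i + 1)) (y (i + 2)) (by
    have := congrArg (Int.cast : ℤ → ZMod p) hy'
    push_cast at this
    rw [(ZMod.intCast_zmod_eq_zero_iff_dvd _ _).mpr h1] at this
    linear_combination this)
  rw [ZMod.intCast_zmod_eq_zero_iff_dvd] at hu hv
  have hpd : ∀ z : ℤ, (p : ℤ) ∣ z → (p : ℤ) ^ 2 ∣ z ^ d := fun z hz =>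
    (pow_dvd_pow _ hd).trans (pow_dvd_pow_of_dvd hz d)
  have hi2 : (p : ℤ) ^ 2 ∣ a i * y i ^ d := by
    have : a i * y i ^ d = -(a (i + 1) * y (i + 1) ^ d) - a (i + 2) * y (i + 2) ^ d := by
      linear_combination hy'
    rw [this]
    exact dvd_sub (dvd_neg.mpr (Dvd.dvd.mul_left (hpd _ hu) _)) (Dvd.dvd.mul_left (hpd _ hv) _)
  have hw : (p : ℤ) ∣ y i := by
    by_contra hcon
    apply h2
    have hnd : ¬ (p : ℤ) ∣ y i ^ d := fun h => hcon (hp.dvd_of_dvd_pow h)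
    push_cast
    exact hp.pow_dvd_of_dvd_mul_right 2 hnd hi2
  have hall : (p : ℤ) ∣ Finset.univ.gcd y := by
    refine Finset.dvd_gcd fun j _ => ?_
    fin_cases i <;> fin_cases j <;> assumption
  rw [hgcd] at hall
  exact hp.not_isUnit (isUnit_of_dvd_one hall)

/-! ### Sieving by the local obstructions -/

section

variable {p : ℕ} [Fact p.Prime] {d : ℕ}

theorem card_obstructed_le (hd : d ≠ 0) (hdp : d ∣ p - 1) :
    (p : ℝ) * (obstructed p d).card ≤ 3 * (p : ℝ) ^ 6 := by
  have hp : (1 : ℝ) ≤ p := by exact_mod_cast (Fact.out : p.Prime).one_le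
  have hd1 : (1 : ℝ) ≤ d := by exact_mod_cast Nat.one_le_iff_ne_zero.mpr hd
  have h0 : 0 ≤ 1 - 1 / (d : ℝ) := by
    rw [sub_nonneg, div_le_one (by linarith)]; exact hd1
  have h1 : 1 - 1 / (d : ℝ) ≤ 1 := by
    have : 0 ≤ 1 / (d : ℝ) := by positivity
    linarith
  have hp1 : (0 : ℝ) ≤ (p : ℝ) - 1 := by linarith
  rw [card_obstructed hd hdp]
  calc (p : ℝ) * (3 * (1 - 1 / d) * (p : ℝ) ^ 2 * (p - 1) ^ 3)
      ≤ (p : ℝ) * (3 * 1 * (p : ℝ) ^ 2 * p ^ 3) := by gcongr; linarith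
    _ = _ := by ring

theorem two_mul_card_obstructed_le (hd : d ≠ 0) (hdp : d ∣ p - 1) (hp7 : 7 ≤ p) :
    2 * ((obstructed p d).card : ℝ) ≤ ((p ^ 2 : ℕ) : ℝ) ^ 3 := by
  have h := card_obstructed_le hd hdp
  have hp : (7 : ℝ) ≤ p := by exact_mod_cast hp7
  have hc : (0 : ℝ) ≤ (obstructed p d).card := by positivity
  push_cast
  nlinarith

theorem sieveOdds_obstructed_le (hd : d ≠ 0) (hdp : d ∣ p - 1) (hp7 : 7 ≤ p) :
    sieveOdds (obstructed p d) ≤ 6 / p := by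
  have h := card_obstructed_le hd hdp
  have h2 := two_mul_card_obstructed_le hd hdp hp7
  have hp : (7 : ℝ) ≤ p := by exact_mod_cast hp7
  have hpos := cube_sub_card_pos _ h2
  rw [sieveOdds, div_le_div_iff₀ hpos (by linarith)]
  push_cast at h2 ⊢
  nlinarith

/-- The local factor `1 + h = 1 / (1 - ω)` is at least `exp ω`, and `(p - 1) ^ 3 / p ^ 4` is at least
`1 / p - 3 / p ^ 2`. -/
theorem exp_le_one_add_sieveOdds_obstructed (hd : d ≠ 0) (hdp : d ∣ p - 1) (hp7 : 7 ≤ p) :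
    Real.exp (3 * (1 - 1 / d) * (1 / (p : ℝ) - 3 * (1 / (p : ℝ) ^ 2))) ≤
      1 + sieveOdds (obstructed p d) := by
  have h2 := two_mul_card_obstructed_le hd hdp hp7
  have hp : (7 : ℝ) ≤ p := by exact_mod_cast hp7
  have hd1 : (1 : ℝ) ≤ d := by exact_mod_cast Nat.one_le_iff_ne_zero.mpr hd
  have h0 : 0 ≤ 1 - 1 / (d : ℝ) := by
    rw [sub_nonneg, div_le_one (by linarith)]; exact hd1
  have hpos := cube_sub_card_pos _ h2
  set m3 : ℝ := ((p ^ 2 : ℕ) : ℝ) ^ 3 with hm3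
  have hm : m3 = (p : ℝ) ^ 6 := by rw [hm3]; push_cast; ring
  have hm0 : 0 < m3 := by rw [hm]; positivity
  set ω : ℝ := (obstructed p d).card / m3 with hω
  have hle : 3 * (1 - 1 / d) * (1 / (p : ℝ) - 3 * (1 / (p : ℝ) ^ 2)) ≤ ω := by
    rw [hω, card_obstructed hd hdp, hm, mul_assoc (3 * (1 - 1 / (d : ℝ))), mul_div_assoc]
    refine mul_le_mul_of_nonneg_left ?_ (by positivity)
    rw [le_div_iff₀ (by positivity)]
    have : (1 / (p : ℝ) - 3 * (1 / (p : ℝ) ^ 2)) * (p : ℝ) ^ 6 = (p : ℝ) ^ 2 * (p ^ 3 - 3 * p ^ 2) := by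
      field_simp
    rw [this]
    refine mul_le_mul_of_nonneg_left ?_ (by positivity)
    nlinarith
  have hω1 : 0 < 1 - ω := by
    rw [hω, sub_pos, div_lt_one hm0]; linarith
  have hodds : 1 + sieveOdds (obstructed p d) = (1 - ω)⁻¹ := by
    rw [sieveOdds, hω, ← hm3]
    field_simp
    ring
  rw [hodds]
  refine (Real.exp_le_exp.mpr hle).trans ?_
  rw [← neg_neg ω, Real.exp_neg]
  refine inv_anti₀ (by simpa using hω1) ?_
  have := Real.add_one_le_exp (-ω)
  simp only [neg_neg]
  linarith

end

/-- The primes `p ≤ z` congruent to `1` modulo `d`, without those below `7`, at which the obstructed triples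
could have density above `1 / 2`. -/
def sievingPrimes (d z : ℕ) : Finset ℕ :=
  (Finset.range (z + 1)).filter fun p : ℕ => p.Prime ∧ (p : ZMod d) = 1 ∧ 7 ≤ p

theorem mem_sievingPrimes {d z p : ℕ} :
    p ∈ sievingPrimes d z ↔ p ≤ z ∧ p.Prime ∧ (p : ZMod d) = 1 ∧ 7 ≤ p := by
  simp [sievingPrimes]

theorem dvd_sub_one_of_mem_sievingPrimes {d z p : ℕ} (h : p ∈ sievingPrimes d z) : d ∣ p - 1 := by
  obtain ⟨-, hp, h1, -⟩ := mem_sievingPrimes.mp h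
  rw [← ZMod.natCast_eq_zero_iff, Nat.cast_sub hp.one_le, h1, Nat.cast_one, sub_self]

theorem exists_log_log_le_sum_sievingPrimes (d : ℕ) [NeZero d] :
    ∃ C : ℝ, ∀ z : ℕ, 3 ≤ z →
      (d.totient : ℝ)⁻¹ * Real.log (Real.log z) - C ≤
        ∑ p ∈ sievingPrimes d z, (1 / (p : ℝ) - 3 * (1 / (p : ℝ) ^ 2)) := by
  obtain ⟨C, hC⟩ := exists_log_log_le_sum_one_div_prime d
  have hs : Summable fun n : ℕ => 1 / (n : ℝ) ^ 2 := Real.summable_one_div_nat_pow.mpr one_lt_two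
  refine ⟨C + 7 + 3 * ∑' n : ℕ, 1 / (n : ℝ) ^ 2, fun z hz => ?_⟩
  have h1 := hC z hz
  have h2 : ∑ p ∈ sievingPrimes d z, 1 / (p : ℝ) ^ 2 ≤ ∑' n : ℕ, 1 / (n : ℝ) ^ 2 :=
    hs.sum_le_tsum _ fun n _ => by positivity
  have h3 : ∑ p ∈ (Finset.range (z + 1)).filter (fun p : ℕ => p.Prime ∧ (p : ZMod d) = 1),
      1 / (p : ℝ) ≤ ∑ p ∈ sievingPrimes d z, 1 / (p : ℝ) + 7 := by
    have hsub : (Finset.range (z + 1)).filter (fun p : ℕ => p.Prime ∧ (p : ZMod d) = 1) ⊆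
        sievingPrimes d z ∪ Finset.range 7 := by
      intro p hp
      simp only [Finset.mem_filter, Finset.mem_range, Finset.mem_union, mem_sievingPrimes] at hp ⊢
      by_cases h7 : p < 7
      · exact Or.inr h7
      · exact Or.inl ⟨by omega, hp.2.1, hp.2.2, by omega⟩
    calc _ ≤ ∑ p ∈ sievingPrimes d z ∪ Finset.range 7, 1 / (p : ℝ) :=
          Finset.sum_le_sum_of_subset_of_nonneg hsub fun _ _ _ => by positivity
      _ ≤ ∑ p ∈ sievingPrimes d z, 1 / (p : ℝ) + ∑ p ∈ Finset.range 7, 1 / (p : ℝ) := by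
          rw [← Finset.sum_union_inter]
          exact le_add_of_nonneg_right (Finset.sum_nonneg fun _ _ => by positivity)
      _ ≤ _ := by
          gcongr
          calc ∑ p ∈ Finset.range 7, 1 / (p : ℝ) ≤ ∑ p ∈ Finset.range 7, (1 : ℝ) := by
                refine Finset.sum_le_sum fun p _ => ?_
                rcases Nat.eq_zero_or_pos p with rfl | h
                · simp
                · rw [div_le_one (by positivity)]
                  exact_mod_cast h
            _ = 7 := by simp
  rw [Finset.sum_sub_distrib, ← Finset.mul_sum]
  linarith

/-- The sieve bound for the soluble triples in a cube of side `N`, with sieving primes up to `z`. -/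
theorem exists_card_cube_soluble_le {d : ℕ} (hd : 2 ≤ d) :
    ∃ A : ℕ, 1 ≤ A ∧ ∃ c : ℝ, 0 < c ∧ ∀ z : ℕ, 3 ≤ z → ∀ (N : ℕ) (b : ℤ), z ^ (2 * A) ≤ N →
      ∀ S : Finset (Fin 3 → ℤ), S ⊆ cube b N → (∀ a ∈ S, FermatSoluble d a) →
        (S.card : ℝ) ≤ 8 * (N : ℝ) ^ 3 / (c * Real.log z ^ fermatExponent d)
          + 3 * (N : ℝ) ^ 2 * (z : ℝ) ^ (4 * A) := by
  classical
  have hd0 : d ≠ 0 := by omega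
  have : NeZero d := ⟨hd0⟩
  obtain ⟨C₁, hC₁⟩ := exists_log_log_le_sum_sievingPrimes d
  obtain ⟨C₂, hC₂0, hC₂⟩ := exists_sum_log_div_le
  set κ : ℝ := 3 * (1 - 1 / d) with hκ
  have hκ0 : 0 ≤ κ := by
    have hd1 : (1 : ℝ) ≤ d := by exact_mod_cast Nat.one_le_iff_ne_zero.mpr hd0
    have : 0 ≤ 1 - 1 / (d : ℝ) := by
      rw [sub_nonneg, div_le_one (by linarith)]; exact hd1
    positivity
  -- The expected logarithm of the modulus of a random `T` is at most `12 * C₂ * log z`: the odds at `p`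
  -- are at most `6 / p` and the modulus is `p ^ 2`. Hence the level `z ^ A` with `A ≥ 24 * C₂`.
  refine ⟨⌈24 * C₂⌉₊, Nat.one_le_ceil_iff.mpr (by positivity), Real.exp (-(κ * C₁)) / 2,
    by positivity, fun z hz N b hN S hS hSol => ?_⟩
  set A := ⌈24 * C₂⌉₊ with hA
  obtain ⟨-, -, hlogz⟩ := one_div_log_natCast_bounds hz
  have hz0 : (0 : ℝ) < z := by positivity
  let ι := {p // p ∈ sievingPrimes d z}
  have hmem : ∀ i : ι, _ := fun i => mem_sievingPrimes.mp i.2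
  have hfact : ∀ i : ι, Fact (i : ℕ).Prime := fun i => ⟨(hmem i).2.1⟩
  let m : ι → ℕ := fun i => (i : ℕ) ^ 2
  have hmne : ∀ i, NeZero (m i) := fun i => ⟨pow_ne_zero 2 (hmem i).2.1.ne_zero⟩
  have hcop : Pairwise (Function.onFun Nat.Coprime m) := fun i j hij =>
    Nat.Coprime.pow 2 2 ((Nat.coprime_primes (hmem i).2.1 (hmem j).2.1).mpr
      fun h => hij (Subtype.ext h))
  let Ω : ∀ i : ι, Finset (Fin 3 → ZMod (m i)) := fun i => obstructed (i : ℕ) d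
  have hdvd : ∀ i : ι, d ∣ (i : ℕ) - 1 := fun i => dvd_sub_one_of_mem_sievingPrimes i.2
  have hΩ : ∀ i, 2 * ((Ω i).card : ℝ) ≤ (m i : ℝ) ^ 3 := fun i =>
    two_mul_card_obstructed_le hd0 (hdvd i) (hmem i).2.2.2
  let h : ι → ℝ := fun i => sieveOdds (Ω i)
  have hh : ∀ i, 0 ≤ h i := fun i => sieveOdds_nonneg _ (hΩ i)
  let w : ι → ℝ := fun i => Real.log (m i)
  have hw : ∀ i, 0 ≤ w i := fun i => Real.log_natCast_nonneg _
  have hW0 : 0 < 12 * C₂ * Real.log z := by positivity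
  have hW : ∑ i, w i * h i ≤ 12 * C₂ * Real.log z := by
    calc ∑ i, w i * h i ≤ ∑ i : ι, 12 * (Real.log (i : ℕ) / (i : ℕ)) := by
          refine Finset.sum_le_sum fun i _ => ?_
          have e : w i = 2 * Real.log (i : ℕ) := by
            simp only [w, m]
            push_cast
            rw [Real.log_pow]
            norm_num
          have hl : 0 ≤ Real.log (i : ℕ) := Real.log_natCast_nonneg _
          calc w i * h i ≤ 2 * Real.log (i : ℕ) * (6 / (i : ℕ)) := by
                rw [e]
                exact mul_le_mul_of_nonneg_left
                  (sieveOdds_obstructed_le hd0 (hdvd i) (hmem i).2.2.2) (by positivity)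
            _ = _ := by ring
      _ = ∑ p ∈ sievingPrimes d z, 12 * (Real.log p / p) :=
          Finset.sum_coe_sort (sievingPrimes d z) fun p => 12 * (Real.log p / p)
      _ ≤ ∑ p ∈ (Finset.range (z + 1)).filter Nat.Prime, 12 * (Real.log p / p) := by
          refine Finset.sum_le_sum_of_subset_of_nonneg ?_ fun p _ _ => ?_
          · intro p hp
            have := mem_sievingPrimes.mp hp
            simp [this.2.1, this.1]
          · exact mul_nonneg (by norm_num) (div_nonneg (Real.log_natCast_nonneg p) (by positivity))
      _ = 12 * ∑ p ∈ (Finset.range (z + 1)).filter Nat.Prime, Real.log p / p := by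
          rw [Finset.mul_sum]
      _ ≤ 12 * (C₂ * Real.log z) := by gcongr; exact hC₂ z hz
      _ = _ := by ring
  set 𝒯 : Finset (Finset ι) := (Finset.univ : Finset ι).powerset.filter
    fun T => ∑ i ∈ T, w i ≤ 2 * (12 * C₂ * Real.log z) with h𝒯
  have hhalf := half_prod_le_sum_truncated Finset.univ h w hh hw hW0 hW
  have hmpos : ∀ i, 0 < m i := fun i => Nat.pos_of_neZero _
  have hlevel : ∀ T ∈ 𝒯, ∏ i ∈ T, m i ≤ z ^ A := by
    intro T hT
    have hT' := (Finset.mem_filter.mp hT).2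
    have hpos : (0 : ℝ) < ∏ i ∈ T, (m i : ℝ) :=
      Finset.prod_pos fun i _ => by exact_mod_cast hmpos i
    have : Real.log (∏ i ∈ T, (m i : ℝ)) ≤ Real.log ((z : ℝ) ^ A) := by
      rw [Real.log_prod fun i _ => by exact_mod_cast (hmpos i).ne', Real.log_pow]
      refine hT'.trans ?_
      calc 2 * (12 * C₂ * Real.log z) = 24 * C₂ * Real.log z := by ring
        _ ≤ A * Real.log z := by gcongr; exact Nat.le_ceil _
    have := (Real.log_le_log_iff hpos (by positivity)).mp this
    exact_mod_cast this
  -- A set of primes is determined by the product of their squares.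
  have hcard𝒯 : 𝒯.card ≤ z ^ A := by
    have hinj : Set.InjOn (fun T : Finset ι => ∏ i ∈ T, m i) (𝒯 : Set (Finset ι)) := by
      have hrec : ∀ (T : Finset ι) (i : ι), i ∈ T ↔ (i : ℕ) ∣ ∏ j ∈ T, m j := by
        intro T i
        rw [(hmem i).2.1.prime.dvd_finsetProd_iff]
        constructor
        · exact fun hi => ⟨i, hi, dvd_pow_self _ two_ne_zero⟩
        · rintro ⟨j, hj, hij⟩
          have := (Nat.prime_dvd_prime_iff_eq (hmem i).2.1 (hmem j).2.1).mp
            ((hmem i).2.1.dvd_of_dvd_pow hij)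
          rwa [Subtype.ext this]
      intro T _ T' _ hTT
      ext i
      rw [hrec T i, hrec T' i]
      simp only at hTT
      rw [hTT]
    calc 𝒯.card ≤ (Finset.Icc 1 (z ^ A)).card :=
          Finset.card_le_card_of_injOn _ (fun T hT => Finset.mem_coe.mpr (Finset.mem_Icc.mpr
            ⟨Finset.prod_pos fun i _ => hmpos i, hlevel T hT⟩)) hinj
      _ = z ^ A := by simp
  set L := ∑ T ∈ 𝒯, ∏ i ∈ T, sieveOdds (Ω i) with hL
  have hL1 : 1 ≤ L := by
    have hempty : ∅ ∈ 𝒯 := by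
      rw [h𝒯, Finset.mem_filter]
      refine ⟨Finset.empty_mem_powerset _, ?_⟩
      rw [Finset.sum_empty]
      linarith
    have := Finset.single_le_sum (f := fun T : Finset ι => ∏ i ∈ T, sieveOdds (Ω i))
      (fun T _ => Finset.prod_nonneg fun i _ => hh i) hempty
    simpa using this
  have hLlow : Real.exp (-(κ * C₁)) / 2 * Real.log z ^ fermatExponent d ≤ L := by
    refine le_trans ?_ hhalf
    have hprod : Real.exp (κ * ((d.totient : ℝ)⁻¹ * Real.log (Real.log z) - C₁)) ≤
        ∏ i, (1 + h i) := by
      calc _ ≤ Real.exp (κ * ∑ p ∈ sievingPrimes d z, (1 / (p : ℝ) - 3 * (1 / (p : ℝ) ^ 2))) :=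
            Real.exp_le_exp.mpr (mul_le_mul_of_nonneg_left (hC₁ z hz) hκ0)
        _ = ∏ i : ι, Real.exp (κ * (1 / ((i : ℕ) : ℝ) - 3 * (1 / ((i : ℕ) : ℝ) ^ 2))) := by
            rw [Finset.mul_sum, Real.exp_sum]
            exact (Finset.prod_coe_sort (sievingPrimes d z) fun p : ℕ =>
              Real.exp (κ * (1 / (p : ℝ) - 3 * (1 / (p : ℝ) ^ 2)))).symm
        _ ≤ _ := Finset.prod_le_prod (fun _ _ => (Real.exp_pos _).le) fun i _ =>
            exp_le_one_add_sieveOdds_obstructed hd0 (hdvd i) (hmem i).2.2.2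
    have hexp : Real.exp (κ * ((d.totient : ℝ)⁻¹ * Real.log (Real.log z) - C₁)) =
        Real.exp (-(κ * C₁)) * Real.log z ^ fermatExponent d := by
      rw [Real.rpow_def_of_pos (by linarith), ← Real.exp_add, fermatExponent]
      congr 1
      rw [hκ]
      ring
    rw [div_mul_eq_mul_div, ← hexp]
    linarith
  have hN' : (z ^ A) ^ 2 ≤ N := by rwa [← pow_mul, mul_comm A 2]
  have hmain := card_sifted_le m Ω hcop hΩ b hN' 𝒯 hlevel S hS
    (fun a ha i => (hSol a ha).notMem_obstructed hd (i : ℕ)) hL1 hL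
  refine hmain.trans (add_le_add ?_ ?_)
  · have : 0 < Real.exp (-(κ * C₁)) / 2 * Real.log z ^ fermatExponent d := by
      have : 0 < Real.log z := by linarith
      positivity
    gcongr
  · have : ((z ^ A : ℕ) : ℝ) ^ 2 * (𝒯.card : ℝ) ^ 2 ≤ (z : ℝ) ^ (4 * A) := by
      have h1 : (𝒯.card : ℝ) ≤ (z : ℝ) ^ A := by exact_mod_cast hcard𝒯
      calc ((z ^ A : ℕ) : ℝ) ^ 2 * (𝒯.card : ℝ) ^ 2
          ≤ ((z : ℝ) ^ A) ^ 2 * ((z : ℝ) ^ A) ^ 2 := by push_cast; gcongr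
        _ = _ := by ring
    rw [mul_assoc]
    gcongr

/-! ### Soluble triples in a box -/

theorem solubleCount_eq_card (d : ℕ) (H : ℝ) :
    solubleCount d H = (solubleTriples_finite d H).toFinset.card :=
  Set.ncard_eq_toFinset_card _ _

theorem coeffBox_eq_cube {H : ℝ} (hH : 0 ≤ H) :
    coeffBox H = cube (-(⌊H⌋₊ : ℤ)) (2 * ⌊H⌋₊ + 1) := by
  ext a
  simp only [coeffBox, cube, Set.mem_ofPred_eq, Finset.mem_coe, Fintype.mem_piFinset,
    Finset.mem_Ico]
  refine forall_congr' fun j => ?_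
  rw [← Int.cast_abs, ← Int.le_floor, ← Int.natCast_floor_eq_floor hH, abs_le]
  push_cast
  constructor <;> rintro ⟨h1, h2⟩ <;> constructor <;> linarith

theorem ncard_coeffBox {H : ℝ} (hH : 0 ≤ H) :
    (coeffBox H).ncard = (2 * ⌊H⌋₊ + 1) ^ 3 := by
  rw [coeffBox_eq_cube hH, Set.ncard_coe_finset, cube, Fintype.card_piFinset]
  simp only [Int.card_Ico, add_sub_cancel_left, Int.toNat_natCast, Finset.prod_const,
    Finset.card_univ, Fintype.card_fin]

theorem side_bounds {H : ℝ} (hH : 1 ≤ H) :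
    H ≤ ((2 * ⌊H⌋₊ + 1 : ℕ) : ℝ) ∧ ((2 * ⌊H⌋₊ + 1 : ℕ) : ℝ) ≤ 3 * H := by
  have h1 := Nat.floor_le (by linarith : 0 ≤ H)
  have h2 := Nat.lt_floor_add_one H
  push_cast
  constructor <;> linarith

theorem solubleCount_le_ncard (d : ℕ) (H : ℝ) : solubleCount d H ≤ (coeffBox H).ncard :=
  Set.ncard_le_ncard (fun _ ha => ha.1) (coeffBox_finite H)

theorem solubleCount_le_cube (d : ℕ) {H : ℝ} (hH : 1 ≤ H) :
    (solubleCount d H : ℝ) ≤ 27 * H ^ 3 := by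
  calc (solubleCount d H : ℝ) ≤ ((coeffBox H).ncard : ℝ) := by
        exact_mod_cast solubleCount_le_ncard d H
    _ = ((2 * ⌊H⌋₊ + 1 : ℕ) : ℝ) ^ 3 := by
        rw [ncard_coeffBox (by linarith)]; push_cast; ring
    _ ≤ (3 * H) ^ 3 := by gcongr; exact (side_bounds hH).2
    _ = _ := by ring

theorem fermatExponent_one : fermatExponent 1 = 0 := by simp [fermatExponent]

theorem fermatExponent_two : fermatExponent 2 = 3 / 2 := by
  norm_num [fermatExponent]

theorem fermatExponent_pos {d : ℕ} (hd : 2 ≤ d) : 0 < fermatExponent d := by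
  have h1 : (0 : ℝ) < d.totient := by exact_mod_cast Nat.totient_pos.mpr (by omega)
  have h2 : (2 : ℝ) ≤ d := by exact_mod_cast hd
  have h3 : 0 < 1 - 1 / (d : ℝ) := by
    rw [sub_pos, div_lt_one (by linarith)]; linarith
  unfold fermatExponent
  positivity

theorem exists_solubleCount_le {d : ℕ} (hd : 2 ≤ d) :
    ∃ C : ℝ, 0 < C ∧ ∀ H : ℝ, 1 < H →
      (solubleCount d H : ℝ) ≤ C * (H ^ 3 / Real.log H ^ fermatExponent d) := by
  obtain ⟨A, hA, c, hc, hmain⟩ := exists_card_cube_soluble_le hd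
  set ψ := fermatExponent d with hψ
  have hψ0 : 0 < ψ := fermatExponent_pos hd
  have hA0 : (0 : ℝ) < A := by exact_mod_cast hA
  -- The sieve is run with `z = ⌊H ^ (2 ε)⌋`, for which `z ^ (4 A) ≤ H ^ (1 / 2)`; for `H ≥ 2 ^ (16 A)` it
  -- satisfies `log z ≥ ε log H`. Smaller `H` are covered by the trivial bound.
  set ε : ℝ := 1 / (16 * A) with hε
  have hε0 : 0 < ε := by positivity
  set H₀ : ℝ := 2 ^ (16 * A) with hH₀
  have hH₀1 : 1 < H₀ := one_lt_pow₀ (by norm_num) (by omega)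
  have hlogH₀ : 0 < Real.log H₀ := Real.log_pos hH₀1
  refine ⟨216 / (c * ε ^ ψ) + 27 * (2 * ψ) ^ ψ + 27 * Real.log H₀ ^ ψ, by positivity,
    fun H hH => ?_⟩
  have hlog : 0 < Real.log H := Real.log_pos hH
  have hlogψ : 0 < Real.log H ^ ψ := by positivity
  have hH0 : 0 < H := by linarith
  rw [add_mul, add_mul]
  have hE1 : 0 ≤ 216 / (c * ε ^ ψ) * (H ^ 3 / Real.log H ^ ψ) := by positivity
  have hE2 : 0 ≤ 27 * (2 * ψ) ^ ψ * (H ^ 3 / Real.log H ^ ψ) := by positivity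
  have hE3 : 0 ≤ 27 * Real.log H₀ ^ ψ * (H ^ 3 / Real.log H ^ ψ) := by positivity
  rcases le_total H H₀ with hsmall | hlarge
  · have h1 : Real.log H ^ ψ ≤ Real.log H₀ ^ ψ :=
      Real.rpow_le_rpow hlog.le (Real.log_le_log hH0 hsmall) hψ0.le
    have h2 : 27 * H ^ 3 ≤ 27 * Real.log H₀ ^ ψ * (H ^ 3 / Real.log H ^ ψ) := by
      rw [mul_assoc, ← mul_div_assoc]
      refine mul_le_mul_of_nonneg_left ?_ (by norm_num)
      rw [le_div_iff₀ hlogψ, mul_comm]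
      gcongr
    linarith [solubleCount_le_cube d hH.le]
  · set z := ⌊H ^ (2 * ε)⌋₊ with hz
    set y := H ^ ε with hy
    have hy2 : 2 ≤ y := by
      have : (2 : ℝ) = H₀ ^ ε := by
        rw [hH₀, ← Real.rpow_natCast, ← Real.rpow_mul (by norm_num), hε]
        push_cast
        rw [mul_one_div_cancel (by positivity), Real.rpow_one]
      rw [this, hy]
      exact Real.rpow_le_rpow (by positivity) hlarge hε0.le
    have hyy : H ^ (2 * ε) = y ^ 2 := by
      rw [hy, ← Real.rpow_natCast, ← Real.rpow_mul hH0.le]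
      congr 1
      push_cast
      ring
    have hzle : (z : ℝ) ≤ H ^ (2 * ε) := Nat.floor_le (by positivity)
    have hzge : y ≤ z := by
      have := Nat.lt_floor_add_one (H ^ (2 * ε))
      rw [← hz, hyy] at this
      nlinarith
    have hz3 : 3 ≤ z := by
      refine Nat.le_floor ?_
      rw [hyy]
      push_cast
      nlinarith
    have hzpow : ∀ k : ℕ, (z : ℝ) ^ (k * A) ≤ H ^ ((k : ℝ) / 8) := by
      intro k
      calc (z : ℝ) ^ (k * A) ≤ (H ^ (2 * ε)) ^ (k * A) := by gcongr
        _ = H ^ ((k : ℝ) / 8) := by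
          rw [← Real.rpow_natCast, ← Real.rpow_mul hH0.le]
          congr 1
          rw [hε]
          push_cast
          field_simp
          ring
    set N := 2 * ⌊H⌋₊ + 1 with hN
    obtain ⟨hN1, hN2⟩ := side_bounds hH.le
    rw [← hN] at hN1 hN2
    have hzN : z ^ (2 * A) ≤ N := by
      have h1 : H ^ (((2 : ℕ) : ℝ) / 8) ≤ H ^ (1 : ℝ) :=
        Real.rpow_le_rpow_of_exponent_le hH.le (by norm_num)
      rw [Real.rpow_one] at h1
      exact_mod_cast (hzpow 2).trans (h1.trans hN1)
    have hcount := hmain z hz3 N (-(⌊H⌋₊ : ℤ)) hzN (solubleTriples_finite d H).toFinset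
      (by
        intro a ha
        have h1 : a ∈ coeffBox H := ((solubleTriples_finite d H).mem_toFinset.mp ha).1
        rw [coeffBox_eq_cube hH0.le] at h1
        exact h1)
      fun a ha => ((solubleTriples_finite d H).mem_toFinset.mp ha).2
    rw [← solubleCount_eq_card] at hcount
    have hlogz : ε * Real.log H ≤ Real.log z := by
      rw [← Real.log_rpow hH0]
      exact Real.log_le_log (by positivity) hzge
    have hT1 : 8 * (N : ℝ) ^ 3 / (c * Real.log z ^ ψ) ≤
        216 / (c * ε ^ ψ) * (H ^ 3 / Real.log H ^ ψ) := by
      calc 8 * (N : ℝ) ^ 3 / (c * Real.log z ^ ψ)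
          ≤ 8 * (3 * H) ^ 3 / (c * (ε * Real.log H) ^ ψ) := by gcongr
        _ = _ := by
          rw [Real.mul_rpow hε0.le hlog.le]
          field_simp
          norm_num
    have hT2 : 3 * (N : ℝ) ^ 2 * (z : ℝ) ^ (4 * A) ≤
        27 * (2 * ψ) ^ ψ * (H ^ 3 / Real.log H ^ ψ) := by
      have hlogle : Real.log H ^ ψ ≤ (2 * ψ) ^ ψ * H ^ (1 / 2 : ℝ) := by
        have h1 : Real.log H ≤ H ^ (1 / (2 * ψ)) / (1 / (2 * ψ)) :=
          Real.log_le_rpow_div hH0.le (by positivity)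
        calc Real.log H ^ ψ ≤ (H ^ (1 / (2 * ψ)) / (1 / (2 * ψ))) ^ ψ :=
              Real.rpow_le_rpow hlog.le h1 hψ0.le
          _ = (2 * ψ * H ^ (1 / (2 * ψ))) ^ ψ := by congr 1; field_simp
          _ = (2 * ψ) ^ ψ * H ^ (1 / 2 : ℝ) := by
              rw [Real.mul_rpow (by positivity) (by positivity), ← Real.rpow_mul hH0.le]
              congr 2
              field_simp
      have hz4 : (z : ℝ) ^ (4 * A) ≤ H ^ (1 / 2 : ℝ) := by
        have := hzpow 4
        norm_num at this
        exact this
      have hhalf : H ^ (1 / 2 : ℝ) * H ^ (1 / 2 : ℝ) = H := by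
        rw [← Real.rpow_add hH0]
        norm_num
      calc 3 * (N : ℝ) ^ 2 * (z : ℝ) ^ (4 * A) ≤ 3 * (3 * H) ^ 2 * H ^ (1 / 2 : ℝ) := by gcongr
        _ = 27 * (H ^ 2 * H ^ (1 / 2 : ℝ)) := by ring
        _ ≤ 27 * ((2 * ψ) ^ ψ * (H ^ 3 / Real.log H ^ ψ)) := by
            refine mul_le_mul_of_nonneg_left ?_ (by norm_num)
            rw [← mul_div_assoc, le_div_iff₀ hlogψ]
            calc H ^ 2 * H ^ (1 / 2 : ℝ) * Real.log H ^ ψ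
                ≤ H ^ 2 * H ^ (1 / 2 : ℝ) * ((2 * ψ) ^ ψ * H ^ (1 / 2 : ℝ)) := by gcongr
              _ = (2 * ψ) ^ ψ * (H ^ 2 * (H ^ (1 / 2 : ℝ) * H ^ (1 / 2 : ℝ))) := by ring
              _ = (2 * ψ) ^ ψ * H ^ 3 := by rw [hhalf]; ring
        _ = _ := by ring
    linarith

theorem tendsto_solubleCount_div {d : ℕ} (hd : 2 ≤ d) :
    Filter.Tendsto (fun H : ℝ => (solubleCount d H : ℝ) / ((coeffBox H).ncard : ℝ))
      Filter.atTop (nhds 0) := by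
  obtain ⟨C, hC, hbound⟩ := exists_solubleCount_le hd
  have hlim : Filter.Tendsto (fun H : ℝ => C * (Real.log H ^ fermatExponent d)⁻¹)
      Filter.atTop (nhds 0) := by
    have := ((tendsto_rpow_atTop (fermatExponent_pos hd)).comp
      Real.tendsto_log_atTop).inv_tendsto_atTop.const_mul C
    simpa using this
  refine squeeze_zero' (Filter.Eventually.of_forall fun H => by positivity) ?_ hlim
  filter_upwards [Filter.eventually_gt_atTop 1] with H hH
  have hH0 : 0 < H := by linarith
  have hcard : H ^ 3 ≤ ((coeffBox H).ncard : ℝ) := by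
    rw [ncard_coeffBox hH0.le, Nat.cast_pow]
    gcongr
    exact (side_bounds hH.le).1
  have hlog : 0 < Real.log H := Real.log_pos hH
  calc (solubleCount d H : ℝ) / ((coeffBox H).ncard : ℝ)
      ≤ C * (H ^ 3 / Real.log H ^ fermatExponent d) / H ^ 3 := by
        gcongr
        exact hbound H hH
    _ = _ := by field_simp

theorem theorem1 :
    (∀ d : ℕ, 1 ≤ d → ∃ C : ℝ, 0 < C ∧ ∀ H : ℝ, 1 < H →
      (solubleCount d H : ℝ) ≤ C * (H ^ 3 / (Real.log H) ^ fermatExponent d)) ∧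
    (∀ d : ℕ, 2 ≤ d →
      Filter.Tendsto (fun H : ℝ => (solubleCount d H : ℝ) / ((coeffBox H).ncard : ℝ))
        Filter.atTop (nhds 0)) ∧
    (∃ C : ℝ, 0 < C ∧ ∀ H : ℝ, 1 < H →
      (solubleCount 2 H : ℝ) ≤ C * (H ^ 3 / (Real.log H) ^ (3 / 2 : ℝ))) := by
  refine ⟨fun d hd => ?_, fun d hd => tendsto_solubleCount_div hd, ?_⟩
  · rcases hd.eq_or_lt with rfl | hd
    · refine ⟨27, by norm_num, fun H hH => ?_⟩
      rw [fermatExponent_one, Real.rpow_zero, div_one]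
      exact solubleCount_le_cube 1 hH.le
    · exact exists_solubleCount_le hd
  · rw [← fermatExponent_two]
    exact exists_solubleCount_le le_rfl
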